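/- \textbf{Setting.} Let $\alpha\ge 0$, $\beta>0$, $L>0$. A \emph{rod} of length $L$ with closed centerline consists of a smooth $L$-periodic unit-speed curve $\gamma:\mathbb R\to\mathbb R^3$ with nowhere vanishing curvature and of smooth vector fields $M_1,M_2$ along $\gamma$ such that $(M_1,M_2,T)$, $T=\gamma'$, is a right-handed orthonormal frame (the material frame, not required to be $L$-periodic). Its strains $u_1,u_2,u_3$ are the components of the Darboux vector of this frame; $u_3=\langle M_1',M_2\rangle$ is the twist rate and $u_1^2+u_2^2=\kappa^2$, with $\kappa$ the curvature of $\gamma$. Its energy is $$\mathcal E=\int_0^L \alpha(u_1^2+u_2^2)+\beta u_3^2\,ds=\int_0^L\alpha\kappa^2+\beta u_3^2\,ds .$$ Let $N,B$ be the principal normal and binormal of $\gamma$ and write $M_1=N\cos\psi+B\sin\psi$ on $[0,L]$ with $\psi$ continuous; put $\Delta\psi=\psi(L)-\psi(0)$. For an integer $r\ge1$, rods of length $L$ are compared in the topology of uniform convergence on $[0,L]$ of the centerline and of the derivatives up to order $r$ of the material frame $(M_1,M_2,T)$. A rod is \emph{stable} if it is a local minimum of $\mathcal E$, in this topology, among all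 rods of the same length $L$ with closed centerline and with the same value of $\Delta\psi$; otherwise it is \emph{unstable}. \textbf{Proposition.} Consider an elastic rod whose centerline is a once-covered circle of length $L$; its twist rate is a constant, $u_3\equiv m$. Then, for every $r\ge 1$, the rod is stable if $$|m|<\sqrt3\,\frac{2\pi\alpha}{L\beta},$$ and unstable if $$|m|>\sqrt3\,\frac{2\pi\alpha}{L\beta}.$$ -/

import Mathlib

open scoped ContDiff

noncomputable section

namespace ElasticRod

/-- Euclidean three-space. -/
abbrev E3 : Type := EuclideanSpace ℝ (Fin 3)

/-- The vector product of `E3`. -/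
def cross (v w : E3) : E3 :=
  WithLp.toLp 2 (crossProduct (WithLp.ofLp v) (WithLp.ofLp w))

/-- A rod with closed centerline of length `L`: a smooth closed curve `γ`, parametrized by
arclength and without inflection points, together with a smooth material frame
`(M₁, M₂, T)`, a right-handed orthonormal frame along `γ` with `T = γ'`.
The material frame is not required to close up: the two ends of the rod are glued with an
arbitrary rotation. Only the restriction of the frame to `[0, L]` is ever used. -/
structure Rod (L : ℝ) where
  /-- the centerline -/
  γ : ℝ → E3
  /-- the first material vector field -/
  M₁ : ℝ → E3
  /-- the second material vector field -/
  M₂ : ℝ → E3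
  smooth_γ : ContDiff ℝ ∞ γ
  smooth_M₁ : ContDiff ℝ ∞ M₁
  smooth_M₂ : ContDiff ℝ ∞ M₂
  closed : Function.Periodic γ L
  unit_speed : ∀ s, ‖deriv γ s‖ = 1
  no_inflection : ∀ s, deriv (deriv γ) s ≠ 0
  norm_M₁ : ∀ s, ‖M₁ s‖ = 1
  norm_M₂ : ∀ s, ‖M₂ s‖ = 1
  orthogonal : ∀ s, inner ℝ (M₁ s) (M₂ s) = 0
  oriented : ∀ s, cross (M₁ s) (M₂ s) = deriv γ s

namespace Rod

variable {L : ℝ}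

/-- The unit tangent vector. -/
def T (Γ : Rod L) : ℝ → E3 := deriv Γ.γ

/-- The principal normal of the centerline. -/
def N (Γ : Rod L) (s : ℝ) : E3 := ‖deriv Γ.T s‖⁻¹ • deriv Γ.T s

/-- The binormal of the centerline. -/
def B (Γ : Rod L) (s : ℝ) : E3 := cross (Γ.T s) (Γ.N s)

/-- First material strain. The strains are the components of the Darboux vector
`u = u₁ M₁ + u₂ M₂ + u₃ T`, for which the derivative of each frame vector `X` is `u × X`:
`T' = u₂ M₁ - u₁ M₂`, `M₁' = u₃ M₂ - u₂ T`, `M₂' = u₁ T - u₃ M₁`. -/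
def u₁ (Γ : Rod L) (s : ℝ) : ℝ := -inner ℝ (deriv Γ.T s) (Γ.M₂ s)

/-- Second material strain. -/
def u₂ (Γ : Rod L) (s : ℝ) : ℝ := inner ℝ (deriv Γ.T s) (Γ.M₁ s)

/-- Third material strain: the twist rate of the rod. -/
def u₃ (Γ : Rod L) (s : ℝ) : ℝ := inner ℝ (deriv Γ.M₁ s) (Γ.M₂ s)

/-- The elastic energy of a uniform symmetric rod with bending stiffness `α` and twisting
stiffness `β`. -/
def energy (α β : ℝ) (Γ : Rod L) : ℝ :=
  ∫ s in (0 : ℝ)..L, (α * (Γ.u₁ s ^ 2 + Γ.u₂ s ^ 2) + β * Γ.u₃ s ^ 2)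

/-- `Γ.HasDeltaPsi d` says that `d` is the total change over `[0, L]` of the angle `ψ`, chosen
continuously, such that `M₁ = N cos ψ + B sin ψ`: the twisting of the material frame relative
to the Frenet frame of the centerline. -/
def HasDeltaPsi (Γ : Rod L) (d : ℝ) : Prop :=
  ∃ ψ : ℝ → ℝ, ContinuousOn ψ (Set.Icc 0 L) ∧
    (∀ s ∈ Set.Icc 0 L, Γ.M₁ s = Real.cos (ψ s) • Γ.N s + Real.sin (ψ s) • Γ.B s) ∧
    ψ L - ψ 0 = d

/-- The rods `Γ` and `Γ'` are `ε`-close to order `r`: their centerlines are uniformly `ε`-close,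
and their material frames `(M₁, M₂, T)` are `ε`-close in the `C^r` sense on `[0, L]`. -/
def Close (r : ℕ) (ε : ℝ) (Γ Γ' : Rod L) : Prop :=
  ∀ s ∈ Set.Icc 0 L, ‖Γ'.γ s - Γ.γ s‖ < ε ∧ ∀ j ≤ r,
    ‖iteratedDeriv j Γ'.T s - iteratedDeriv j Γ.T s‖ < ε ∧
    ‖iteratedDeriv j Γ'.M₁ s - iteratedDeriv j Γ.M₁ s‖ < ε ∧
    ‖iteratedDeriv j Γ'.M₂ s - iteratedDeriv j Γ.M₂ s‖ < ε

/-- Stability: `Γ` is a local minimum of the elastic energy among the rods with closed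
centerline of the same length `L` and with the same value of `Δψ`, locally being meant in the
`C^r` topology on material frames. -/
def IsStable (α β : ℝ) (r : ℕ) (Γ : Rod L) : Prop :=
  ∃ ε > 0, ∀ Γ' : Rod L, (∃ d, Γ.HasDeltaPsi d ∧ Γ'.HasDeltaPsi d) →
    Close r ε Γ Γ' → energy α β Γ ≤ energy α β Γ'

/-- The centerline is a circle, traversed once (so its radius is `L / (2 π)`). -/
def HasCircularCenterline (Γ : Rod L) : Prop :=
  ∃ (c e₁ e₂ : E3) (R : ℝ), Orthonormal ℝ ![e₁, e₂] ∧ 2 * Real.pi * R = L ∧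
    ∀ s, Γ.γ s = c + (R * Real.cos (s / R)) • e₁ + (R * Real.sin (s / R)) • e₂

/-- The twist rate is equal to the constant `m` along the rod. -/
def HasConstantTwistRate (Γ : Rod L) (m : ℝ) : Prop :=
  ∀ s ∈ Set.Icc 0 L, Γ.u₃ s = m

end Rod

end ElasticRod

end

open scoped ContDiff

/-! ### Vector algebra, orthonormal frames, and the angle between two frames -/

namespace ElasticRod

/-! Put k = 2π/L. Fix an axis e and describe the tangent T by its height z = ⟨T, e⟩ and its
longitude rate Ω about e. Then κ² = (1 - z²)Ω² + z'²/(1 - z²). The frame formed by the azimuthal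
direction and T has twist rate zΩ. By `hasDeltaPsi_iff`, prescribing Δψ amounts to prescribing ∫(u₃
- zΩ), because the principal normal stays within a right angle of the azimuthal direction. The
circle has z = 0, Ω = k, u₃ = m and Δψ = mL.

Stability. For a nearby rod, closure gives ∫z = 0, and the winding number of T about e is one, so ∫Ω
= 2π. The axis is chosen normal to both first Fourier coefficients of T, so z has no modes of order
±1 either, and Wirtinger's inequality improves to ∫z'² ≥ 4k²∫z² (`wirtinger_of_modes_ge_two`).
Subtracting from the energy density the terms whose integrals are thus known leaves a quadratic form
in Ω - k and z. It is nonnegative when (βm)² ≤ α²(4k² - Ω²), which is 3α²k² in the limit Ω → k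
(`energy_density_lower_bound`, integrated in `le_energy`). So the minimality holds for whole curves,
with no second variation argument.

Instability. The second Fourier mode is the critical one. The rods of `exists_buckled` have latitude
p cos 2ks and longitude ks + (cp/2k) sin 2ks. They are closed by symmetry and have the same Δψ, and
their energy exceeds that of the circle by at most p²(L/2)(α(c² + 3k²) + 2βmc) + O(|p|³). For c =
∓√3 k the coefficient is negative as soon as β|m| > √3 αk. The family is jointly smooth in p and s,
so small p gives rods that are close to any order r. -/

/-- The vector product as a continuous bilinear map. -/
noncomputable def crossL : E3 →L[ℝ] E3 →L[ℝ] E3 :=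
  (LinearMap.mk₂ ℝ cross
    (fun a b c => by simp [cross]) (fun r a b => by simp [cross])
    (fun a b c => by simp [cross]) (fun r a b => by simp [cross])).toContinuousBilinearMap

theorem cross_add_left (a b c : E3) : cross (a + b) c = cross a c + cross b c := by simp [cross]
theorem cross_add_right (a b c : E3) : cross a (b + c) = cross a b + cross a c := by simp [cross]
theorem cross_smul_left (r : ℝ) (a b : E3) : cross (r • a) b = r • cross a b := by simp [cross]
theorem cross_smul_right (r : ℝ) (a b : E3) : cross a (r • b) = r • cross a b := by simp [cross]
theorem cross_sub_right (a b c : E3) : cross a (b - c) = cross a b - cross a c := by simp [cross]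
theorem cross_anticomm' (a b : E3) : cross a b = -cross b a := by
  rw [cross, ← cross_anticomm, WithLp.toLp_neg, cross]

theorem inner_eq_sum (a b : E3) : inner ℝ a b = a 0 * b 0 + a 1 * b 1 + a 2 * b 2 := by
  rw [PiLp.inner_apply, Fin.sum_univ_three]
  simp only [RCLike.inner_apply, RCLike.conj_to_real]
  ring

theorem cross_apply_zero (a b : E3) : cross a b 0 = a 1 * b 2 - a 2 * b 1 := by
  simp [cross, cross_apply]
theorem cross_apply_one (a b : E3) : cross a b 1 = a 2 * b 0 - a 0 * b 2 := by
  simp [cross, cross_apply]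
theorem cross_apply_two (a b : E3) : cross a b 2 = a 0 * b 1 - a 1 * b 0 := by
  simp [cross, cross_apply]

theorem inner_cross_cross (a b c d : E3) : inner ℝ (cross a b) (cross c d) =
    inner ℝ a c * inner ℝ b d - inner ℝ a d * inner ℝ b c := by
  simp only [inner_eq_sum, cross_apply_zero, cross_apply_one, cross_apply_two]; ring

theorem inner_cross_left_self (a b : E3) : inner ℝ a (cross a b) = 0 := by
  simp only [inner_eq_sum, cross_apply_zero, cross_apply_one, cross_apply_two]; ring

theorem inner_cross_right_self (a b : E3) : inner ℝ b (cross a b) = 0 := by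
  simp only [inner_eq_sum, cross_apply_zero, cross_apply_one, cross_apply_two]; ring

theorem inner_cross_cyclic (a b c : E3) : inner ℝ a (cross b c) = inner ℝ b (cross c a) := by
  simp only [inner_eq_sum, cross_apply_zero, cross_apply_one, cross_apply_two]; ring

theorem cross_cross_right (a b c : E3) :
    cross a (cross b c) = inner ℝ a c • b - inner ℝ a b • c := by
  ext i; fin_cases i <;>
  simp [inner_eq_sum, cross_apply_zero, cross_apply_one, cross_apply_two] <;> ring

/-- A right-handed orthonormal frame of `E3`. -/
structure IsFrame (a b c : E3) : Prop where
  one : inner ℝ a a = 1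
  two : inner ℝ b b = 1
  orth : inner ℝ a b = 0
  cross_eq : cross a b = c

namespace IsFrame

variable {a b c : E3}

theorem three (h : IsFrame a b c) : inner ℝ c c = 1 := by
  rw [← h.cross_eq, inner_cross_cross, h.one, h.two, h.orth, real_inner_comm, h.orth]; ring

theorem orth₁₃ (h : IsFrame a b c) : inner ℝ a c = 0 := by
  rw [← h.cross_eq, inner_cross_left_self]

theorem orth₂₃ (h : IsFrame a b c) : inner ℝ b c = 0 := by
  rw [← h.cross_eq, inner_cross_right_self]

theorem cross₂₃ (h : IsFrame a b c) : cross b c = a := by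
  rw [← h.cross_eq, cross_cross_right, h.two, real_inner_comm, h.orth]; simp

theorem cross₃₁ (h : IsFrame a b c) : cross c a = b := by
  rw [cross_anticomm', ← h.cross_eq, cross_cross_right, h.one, h.orth]; simp

theorem rotate (h : IsFrame a b c) : IsFrame b c a :=
  ⟨h.two, h.three, h.orth₂₃, h.cross₂₃⟩

/-- The double product c × (v × c) is the part of v normal to c; computing it once directly and once
with c = a × b gives the expansion. -/
theorem expand (h : IsFrame a b c) (v : E3) :
    v = inner ℝ v a • a + inner ℝ v b • b + inner ℝ v c • c := by
  have h1 : cross c (cross v c) = v - inner ℝ v c • c := by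
    rw [cross_cross_right, h.three, real_inner_comm]; simp
  have h2 : cross c (cross v c) = inner ℝ v a • a + inner ℝ v b • b := by
    conv_lhs => rw [← h.cross_eq]
    rw [cross_cross_right v a b, h.cross_eq, cross_sub_right, cross_smul_right, cross_smul_right,
      h.cross₃₁, cross_anticomm' c b, h.cross₂₃]
    module
  rw [← h2, h1]; abel

theorem inner_expand (h : IsFrame a b c) (v w : E3) : inner ℝ v w =
    inner ℝ v a * inner ℝ w a + inner ℝ v b * inner ℝ w b + inner ℝ v c * inner ℝ w c := by
  conv_lhs => rw [h.expand v]
  simp only [inner_add_left, inner_smul_left, RCLike.conj_to_real]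
  rw [real_inner_comm w a, real_inner_comm w b, real_inner_comm w c]

end IsFrame

/-- Two smooth frames sharing their third vector differ by a smooth rotation angle, whose
derivative is the difference of the twist rates. -/
theorem exists_angle {X₁ X₂ E₁ E₂ t : ℝ → E3} (hX : ∀ s, IsFrame (X₁ s) (X₂ s) (t s))
    (hE : ∀ s, IsFrame (E₁ s) (E₂ s) (t s)) (sX₁ : ContDiff ℝ ∞ X₁) (sX₂ : ContDiff ℝ ∞ X₂)
    (sE₁ : ContDiff ℝ ∞ E₁) (sE₂ : ContDiff ℝ ∞ E₂) :
    ∃ χ : ℝ → ℝ, ContDiff ℝ ∞ χ ∧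
      (∀ s, HasDerivAt χ (inner ℝ (deriv X₁ s) (X₂ s) - inner ℝ (deriv E₁ s) (E₂ s)) s) ∧
      ∀ s, X₁ s = Real.cos (χ s) • E₁ s + Real.sin (χ s) • E₂ s := by
  set g : ℝ → ℝ := fun s => inner ℝ (deriv X₁ s) (X₂ s) - inner ℝ (deriv E₁ s) (E₂ s) with hg
  have sg : ContDiff ℝ ∞ g :=
    ((contDiff_infty_iff_deriv.1 sX₁).2.inner ℝ sX₂).sub
      ((contDiff_infty_iff_deriv.1 sE₁).2.inner ℝ sE₂)
  have dX₁ : ∀ s, HasDerivAt X₁ (deriv X₁ s) s := fun s =>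
    (sX₁.differentiable (by simp) s).hasDerivAt
  have dE₁ : ∀ s, HasDerivAt E₁ (deriv E₁ s) s := fun s =>
    (sE₁.differentiable (by simp) s).hasDerivAt
  have dE₂ : ∀ s, HasDerivAt E₂ (deriv E₂ s) s := fun s =>
    (sE₂.differentiable (by simp) s).hasDerivAt
  have self_zero : ∀ {Y : ℝ → E3} (_ : ∀ s, HasDerivAt Y (deriv Y s) s)
      (_ : ∀ s, inner ℝ (Y s) (Y s) = 1) (s : ℝ), inner ℝ (deriv Y s) (Y s) = (0 : ℝ) := by
    intro Y dY hY s
    have h1 := (dY s).inner ℝ (dY s)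
    have h2 : (fun s => inner ℝ (Y s) (Y s)) = fun _ => (1 : ℝ) := funext hY
    rw [h2] at h1
    have h3 := h1.unique (hasDerivAt_const s (1 : ℝ))
    rw [real_inner_comm (Y s) (deriv Y s)] at h3
    linarith [real_inner_comm (Y s) (deriv Y s)]
  set c : ℝ → ℝ := fun s => inner ℝ (X₁ s) (E₁ s) with hc
  set d : ℝ → ℝ := fun s => inner ℝ (X₁ s) (E₂ s) with hd
  have X₁eq : ∀ s, X₁ s = c s • E₁ s + d s • E₂ s := fun s => by
    have := (hE s).expand (X₁ s)
    rw [(hX s).orth₁₃] at this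
    simpa using this
  have X₂eq : ∀ s, X₂ s = c s • E₂ s - d s • E₁ s := fun s => by
    rw [← (hX s).cross₃₁, X₁eq s, cross_add_right, cross_smul_right, cross_smul_right,
      (hE s).cross₃₁, cross_anticomm', (hE s).cross₂₃]
    module
  have cd : ∀ s, c s ^ 2 + d s ^ 2 = 1 := fun s => by
    have := (hE s).inner_expand (X₁ s) (X₁ s)
    rw [(hX s).orth₁₃, (hX s).one] at this
    simp only [hc, hd]; linarith
  have E21 : ∀ s, inner ℝ (E₂ s) (E₁ s) = (0 : ℝ) := fun s => by
    rw [real_inner_comm, (hE s).orth]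
  have dE12 : ∀ s, inner ℝ (deriv E₂ s) (E₁ s) = -(inner ℝ (deriv E₁ s) (E₂ s) : ℝ) := by
    intro s
    have h1 := (dE₂ s).inner ℝ (dE₁ s)
    have h2 : (fun s => inner ℝ (E₂ s) (E₁ s)) = fun _ => (0 : ℝ) := funext E21
    rw [h2] at h1
    have h3 := h1.unique (hasDerivAt_const s (0 : ℝ))
    rw [real_inner_comm] at h3
    linarith
  -- With the next derivative: (c, d) solves c' = -g d, d' = g c, the system satisfied by (cos χ,
  -- sin χ) whenever χ' = g.
  have dc : ∀ s, HasDerivAt c (-(g s) * d s) s := by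
    intro s
    refine ((dX₁ s).inner ℝ (dE₁ s)).congr_deriv ?_
    have e1 := (hX s).inner_expand (deriv X₁ s) (E₁ s)
    rw [self_zero dX₁ (fun s => (hX s).one), real_inner_comm (t s) (E₁ s),
      real_inner_comm (E₁ s) (t s), (hE s).orth₁₃] at e1
    have e2 : inner ℝ (E₁ s) (X₂ s) = -d s := by
      rw [X₂eq s, inner_sub_right, inner_smul_right, inner_smul_right, (hE s).orth, (hE s).one]
      ring
    have e3 := (hE s).inner_expand (X₁ s) (deriv E₁ s)
    rw [(hX s).orth₁₃, self_zero dE₁ (fun s => (hE s).one)] at e3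
    rw [e1, e3, e2]
    simp only [hg, hd]
    ring
  have dd : ∀ s, HasDerivAt d (g s * c s) s := by
    intro s
    refine ((dX₁ s).inner ℝ (dE₂ s)).congr_deriv ?_
    have e1 := (hX s).inner_expand (deriv X₁ s) (E₂ s)
    rw [self_zero dX₁ (fun s => (hX s).one), (hE s).orth₂₃] at e1
    have e2 : inner ℝ (E₂ s) (X₂ s) = c s := by
      rw [X₂eq s, inner_sub_right, inner_smul_right, inner_smul_right, E21, (hE s).two]
      ring
    have e3 := (hE s).inner_expand (X₁ s) (deriv E₂ s)
    rw [(hX s).orth₁₃, self_zero dE₂ (fun s => (hE s).two), dE12] at e3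
    rw [e1, e3, e2]
    simp only [hg, hc]
    ring
  -- The angle is obtained by integrating its derivative, with the argument of (c 0, d 0) as initial
  -- value; no lifting of a map to the circle is needed.
  set χ : ℝ → ℝ := fun s => Complex.arg ⟨c 0, d 0⟩ + ∫ x in (0 : ℝ)..s, g x with hχ
  have dχ : ∀ s, HasDerivAt χ (g s) s := fun s =>
    (intervalIntegral.integral_hasDerivAt_right (sg.continuous.intervalIntegrable _ _)
      (sg.continuous.stronglyMeasurableAtFilter _ _) sg.continuous.continuousAt).const_add _
  have sχ : ContDiff ℝ ∞ χ := contDiff_infty_iff_deriv.2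
    ⟨fun s => (dχ s).differentiableAt, by rwa [funext fun s => (dχ s).deriv]⟩
  have n0 : ‖(⟨c 0, d 0⟩ : ℂ)‖ = 1 := by
    rw [Complex.norm_def, Complex.normSq_mk, Real.sqrt_eq_one]; linarith [cd 0]
  have z0 : (⟨c 0, d 0⟩ : ℂ) ≠ 0 := by rw [← norm_ne_zero_iff, n0]; simp
  have c0 : Real.cos (χ 0) = c 0 := by simp [hχ, Complex.cos_arg z0, n0]
  have d0 : Real.sin (χ 0) = d 0 := by simp [hχ, Complex.sin_arg, n0]
  -- The cosine and sine of the angle from (cos χ, sin χ) to (c, d) are constant, so the two unit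
  -- vectors, equal at 0, agree everywhere.
  have hP : ∀ s, c s * Real.cos (χ s) + d s * Real.sin (χ s) = 1 := by
    intro s
    have hder : ∀ s, HasDerivAt (fun s => c s * Real.cos (χ s) + d s * Real.sin (χ s)) 0 s :=
      fun s => (((dc s).mul (dχ s).cos).add ((dd s).mul (dχ s).sin)).congr_deriv (by ring)
    have := is_const_of_deriv_eq_zero (fun s => (hder s).differentiableAt)
      (fun s => (hder s).deriv) s 0
    beta_reduce at this
    rw [this, c0, d0]; linarith [cd 0]
  have hQ : ∀ s, d s * Real.cos (χ s) - c s * Real.sin (χ s) = 0 := by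
    intro s
    have hder : ∀ s, HasDerivAt (fun s => d s * Real.cos (χ s) - c s * Real.sin (χ s)) 0 s :=
      fun s => (((dd s).mul (dχ s).cos).sub ((dc s).mul (dχ s).sin)).congr_deriv (by ring)
    have := is_const_of_deriv_eq_zero (fun s => (hder s).differentiableAt)
      (fun s => (hder s).deriv) s 0
    beta_reduce at this
    rw [this, c0, d0]; ring
  refine ⟨χ, sχ, dχ, fun s => ?_⟩
  have hcs : Real.cos (χ s) = c s := by
    linear_combination c s * Real.sin_sq_add_cos_sq (χ s) -
      Real.cos (χ s) * hP s + Real.sin (χ s) * hQ s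
  have hsn : Real.sin (χ s) = d s := by
    linear_combination d s * Real.sin_sq_add_cos_sq (χ s) -
      Real.sin (χ s) * hP s - Real.cos (χ s) * hQ s
  rw [hcs, hsn]; exact X₁eq s

end ElasticRod

/-! ### Computing Δψ from an auxiliary frame -/

namespace ElasticRod

/-- The values lie in 2πℤ; between two different ones, continuity would force an odd multiple of π,
where the cosine is -1. -/
theorem eq_of_cos_eq_one {L : ℝ} (hL : 0 ≤ L) {D : ℝ → ℝ} (hD : ContinuousOn D (Set.Icc 0 L))
    (h : ∀ s ∈ Set.Icc 0 L, Real.cos (D s) = 1) : D L = D 0 := by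
  obtain ⟨m, hm⟩ := (Real.cos_eq_one_iff _).1 (h 0 ⟨le_rfl, hL⟩)
  obtain ⟨n, hn⟩ := (Real.cos_eq_one_iff _).1 (h L ⟨hL, le_rfl⟩)
  have ivt : ∀ y, Real.cos y = -1 → y ∉ Set.uIcc (D 0) (D L) := by
    intro y hy hmem
    rw [← Set.uIcc_of_le hL] at hD h
    obtain ⟨s, hs, rfl⟩ := intermediate_value_uIcc hD hmem
    rw [h s hs] at hy; norm_num at hy
  have hpi := Real.pi_pos
  rcases lt_trichotomy m n with hlt | rfl | hlt
  · exfalso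
    have h1 : (m : ℝ) + 1 ≤ n := by exact_mod_cast hlt
    refine ivt (D 0 + Real.pi) (by rw [Real.cos_add_pi, h 0 ⟨le_rfl, hL⟩]) ?_
    rw [← hm, ← hn]
    exact Set.mem_uIcc_of_le (by linarith) (by nlinarith)
  · rw [← hm, ← hn]
  · exfalso
    have h1 : (n : ℝ) + 1 ≤ m := by exact_mod_cast hlt
    refine ivt (D 0 - Real.pi) (by rw [Real.cos_sub_pi, h 0 ⟨le_rfl, hL⟩]) ?_
    rw [← hm, ← hn]
    exact Set.mem_uIcc_of_ge (by nlinarith) (by linarith)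

namespace Rod

variable {L : ℝ} (Γ : Rod L)

theorem isFrame (s : ℝ) : IsFrame (Γ.M₁ s) (Γ.M₂ s) (Γ.T s) :=
  ⟨by rw [real_inner_self_eq_norm_sq, Γ.norm_M₁, one_pow],
    by rw [real_inner_self_eq_norm_sq, Γ.norm_M₂, one_pow], Γ.orthogonal s, Γ.oriented s⟩

theorem smooth_T : ContDiff ℝ ∞ Γ.T := (contDiff_infty_iff_deriv.1 Γ.smooth_γ).2

theorem smooth_deriv_T : ContDiff ℝ ∞ (deriv Γ.T) := (contDiff_infty_iff_deriv.1 Γ.smooth_T).2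

theorem hasDerivAt_T (s : ℝ) : HasDerivAt Γ.T (deriv Γ.T s) s :=
  (Γ.smooth_T.differentiable (by simp) s).hasDerivAt

theorem hasDerivAt_γ (s : ℝ) : HasDerivAt Γ.γ (Γ.T s) s :=
  (Γ.smooth_γ.differentiable (by simp) s).hasDerivAt

theorem continuous_u₃ : Continuous Γ.u₃ :=
  ((contDiff_infty_iff_deriv.1 Γ.smooth_M₁).2.continuous).inner Γ.smooth_M₂.continuous

theorem periodic_T : Function.Periodic Γ.T L := fun s => by
  have h : (fun s => Γ.γ (s + L)) = Γ.γ := funext Γ.closed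
  rw [T, ← deriv_comp_add_const, h]

theorem periodic_deriv_T : Function.Periodic (deriv Γ.T) L := fun s => by
  have h : (fun s => Γ.T (s + L)) = Γ.T := funext Γ.periodic_T
  rw [← deriv_comp_add_const, h]

theorem inner_T_T (s : ℝ) : inner ℝ (Γ.T s) (Γ.T s) = (1 : ℝ) := (Γ.isFrame s).three

theorem inner_deriv_T_T (s : ℝ) : inner ℝ (deriv Γ.T s) (Γ.T s) = (0 : ℝ) := by
  have h1 := (Γ.hasDerivAt_T s).inner ℝ (Γ.hasDerivAt_T s)
  rw [show (fun s => inner ℝ (Γ.T s) (Γ.T s)) = fun _ => (1 : ℝ) from funext Γ.inner_T_T] at h1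
  have h3 := h1.unique (hasDerivAt_const s (1 : ℝ))
  linarith [real_inner_comm (Γ.T s) (deriv Γ.T s)]

/-- Both sides are ‖T'‖², since T' is normal to T. The bending density can therefore be computed in
whichever frame is convenient. -/
theorem u₁_sq_add_u₂_sq {E₁ E₂ : E3} {s : ℝ} (hE : IsFrame E₁ E₂ (Γ.T s)) :
    Γ.u₁ s ^ 2 + Γ.u₂ s ^ 2 = (inner ℝ (deriv Γ.T s) E₁) ^ 2 + (inner ℝ (deriv Γ.T s) E₂) ^ 2 := by
  have h1 := (Γ.isFrame s).inner_expand (deriv Γ.T s) (deriv Γ.T s)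
  have h2 := hE.inner_expand (deriv Γ.T s) (deriv Γ.T s)
  rw [Γ.inner_deriv_T_T] at h1 h2
  rw [u₁, u₂]
  linarith

theorem continuous_u₁ : Continuous Γ.u₁ :=
  (Γ.smooth_deriv_T.continuous.inner Γ.smooth_M₂.continuous).neg

theorem continuous_u₂ : Continuous Γ.u₂ :=
  Γ.smooth_deriv_T.continuous.inner Γ.smooth_M₁.continuous

theorem continuous_energy_density (α β : ℝ) :
    Continuous fun s => α * (Γ.u₁ s ^ 2 + Γ.u₂ s ^ 2) + β * Γ.u₃ s ^ 2 :=
  (continuous_const.mul ((Γ.continuous_u₁.pow 2).add (Γ.continuous_u₂.pow 2))).add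
    (continuous_const.mul (Γ.continuous_u₃.pow 2))

theorem integral_T : ∫ s in (0 : ℝ)..L, Γ.T s = 0 := by
  rw [intervalIntegral.integral_eq_sub_of_hasDerivAt (fun s _ => Γ.hasDerivAt_γ s)
    (Γ.smooth_T.continuous.intervalIntegrable _ _)]
  have := Γ.closed 0
  rw [zero_add] at this
  rw [this, sub_self]

/-- The change of `ψ` computed from any periodic smooth frame `(E₁, E₂, T)` in which the
principal normal stays in the half-plane of `E₁`. -/
theorem hasDeltaPsi_iff (hL : 0 ≤ L) {E₁ E₂ : ℝ → E3} (hE : ∀ s, IsFrame (E₁ s) (E₂ s) (Γ.T s))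
    (sE₁ : ContDiff ℝ ∞ E₁) (sE₂ : ContDiff ℝ ∞ E₂) (p₁ : E₁ L = E₁ 0) (p₂ : E₂ L = E₂ 0)
    (pos : ∀ s, 0 < (inner ℝ (deriv Γ.T s) (E₁ s) : ℝ)) (d : ℝ) :
    Γ.HasDeltaPsi d ↔ d = ∫ s in (0 : ℝ)..L, (Γ.u₃ s - inner ℝ (deriv E₁ s) (E₂ s)) := by
  obtain ⟨X, sX, dX, hX⟩ := exists_angle Γ.isFrame hE Γ.smooth_M₁ Γ.smooth_M₂ sE₁ sE₂
  have hint : ∫ s in (0 : ℝ)..L, (Γ.u₃ s - inner ℝ (deriv E₁ s) (E₂ s)) = X L - X 0 := by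
    refine intervalIntegral.integral_eq_sub_of_hasDerivAt (fun s _ => dX s)
      (Continuous.intervalIntegrable ?_ _ _)
    exact Γ.continuous_u₃.sub
      ((contDiff_infty_iff_deriv.1 sE₁).2.continuous.inner sE₂.continuous)
  set a : ℝ → ℝ := fun s => inner ℝ (deriv Γ.T s) (E₁ s) with ha
  set b : ℝ → ℝ := fun s => inner ℝ (deriv Γ.T s) (E₂ s) with hb
  -- ν is the angle from E₁ to the principal normal. Since a > 0 the arctangent gives it
  -- continuously, and with equal values at 0 and L, so it contributes nothing to Δψ.
  set ν : ℝ → ℝ := fun s => Real.arctan (b s / a s) with hν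
  have cν : Continuous ν := Real.continuous_arctan.comp
    ((Γ.smooth_deriv_T.continuous.inner sE₂.continuous).div
      (Γ.smooth_deriv_T.continuous.inner sE₁.continuous) fun s => (pos s).ne')
  have νL : ν L = ν 0 := by
    have := Γ.periodic_deriv_T 0
    rw [zero_add] at this
    simp only [hν, ha, hb, this, p₁, p₂]
  have hder : ∀ s, deriv Γ.T s = a s • E₁ s + b s • E₂ s := fun s => by
    have := (hE s).expand (deriv Γ.T s)
    rw [Γ.inner_deriv_T_T] at this
    simpa using this
  have hN : ∀ s, Γ.N s = Real.cos (ν s) • E₁ s + Real.sin (ν s) • E₂ s := by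
    intro s
    have has : 0 < a s := pos s
    have hnorm : ‖deriv Γ.T s‖ = Real.sqrt (a s ^ 2 + b s ^ 2) := by
      rw [← Real.sqrt_sq (norm_nonneg (deriv Γ.T s)), ← real_inner_self_eq_norm_sq,
        (hE s).inner_expand, Γ.inner_deriv_T_T]
      congr 1; simp only [ha, hb]; ring
    have hs : Real.sqrt (1 + (b s / a s) ^ 2) = Real.sqrt (a s ^ 2 + b s ^ 2) / a s := by
      have ha0 : a s ≠ 0 := has.ne'
      rw [show 1 + (b s / a s) ^ 2 = (a s ^ 2 + b s ^ 2) / a s ^ 2 by field_simp,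
        Real.sqrt_div (by positivity), Real.sqrt_sq has.le]
    have hpos : 0 < Real.sqrt (a s ^ 2 + b s ^ 2) := by positivity
    have ha0 : a s ≠ 0 := has.ne'
    rw [N, hnorm, hν]
    simp only [Real.cos_arctan, Real.sin_arctan, hs]
    rw [hder s, smul_add, smul_smul, smul_smul]
    congr 2 <;> field_simp
  have hB : ∀ s, Γ.B s = Real.cos (ν s) • E₂ s - Real.sin (ν s) • E₁ s := by
    intro s
    rw [B, hN, cross_add_right, cross_smul_right, cross_smul_right, (hE s).cross₃₁,
      cross_anticomm', (hE s).cross₂₃]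
    module
  have hNB : ∀ x s, Real.cos x • Γ.N s + Real.sin x • Γ.B s =
      Real.cos (x + ν s) • E₁ s + Real.sin (x + ν s) • E₂ s := by
    intro x s
    rw [hN, hB, Real.cos_add, Real.sin_add]; module
  rw [hint]
  constructor
  · rintro ⟨ψ, cψ, hψ, rfl⟩
    -- Both ψ + ν and X are continuous angles of M₁ in the frame (E₁, E₂), so they differ by a
    -- constant multiple of 2π.
    have h := eq_of_cos_eq_one hL (D := fun s => ψ s + ν s - X s)
      ((cψ.add cν.continuousOn).sub sX.continuous.continuousOn) (fun s hs => by
        have h := hX s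
        rw [hψ s hs, hNB] at h
        have h1 := congrArg (fun v => (inner ℝ v (E₁ s) : ℝ)) h
        have h2 := congrArg (fun v => (inner ℝ v (E₂ s) : ℝ)) h
        simp only [inner_add_left, inner_smul_left, (hE s).one, (hE s).two, (hE s).orth,
          real_inner_comm (E₁ s) (E₂ s), RCLike.conj_to_real, mul_one, mul_zero, add_zero,
          zero_add] at h1 h2
        rw [Real.cos_sub, h1, h2]
        linarith [Real.sin_sq_add_cos_sq (X s)])
    simp only [νL] at h
    linarith
  · rintro rfl
    refine ⟨fun s => X s - ν s, (sX.continuous.sub cν).continuousOn, fun s _ => ?_, ?_⟩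
    · rw [hNB, hX s]; simp
    · simp only [νL]; ring

end Rod

end ElasticRod

/-! ### Wirtinger's inequality with constant 4 -/

open MeasureTheory in
/-- Wirtinger's inequality for periodic functions without Fourier modes of order `-1, 0, 1`. -/
theorem wirtinger_of_modes_ge_two {L : ℝ} (hL : 0 < L) {f f' : ℝ → ℝ}
    (hf : ∀ x, HasDerivAt f (f' x) x) (hf' : Continuous f') (hper : f L = f 0)
    (h0 : ∫ x in (0 : ℝ)..L, f x = 0)
    (hc : ∫ x in (0 : ℝ)..L, f x * Real.cos (2 * Real.pi / L * x) = 0)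
    (hs : ∫ x in (0 : ℝ)..L, f x * Real.sin (2 * Real.pi / L * x) = 0) :
    4 * (2 * Real.pi / L) ^ 2 * ∫ x in (0 : ℝ)..L, f x ^ 2 ≤ ∫ x in (0 : ℝ)..L, f' x ^ 2 := by
  have cf : Continuous f := continuous_iff_continuousAt.2 fun x => (hf x).continuousAt
  set F : ℝ → ℂ := fun x => (f x : ℂ) with hF
  set F' : ℝ → ℂ := fun x => (f' x : ℂ) with hF'
  have cF : Continuous F := Complex.continuous_ofReal.comp cf
  have cF' : Continuous F' := Complex.continuous_ofReal.comp hf'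
  have dF : ∀ x, HasDerivAt F (F' x) x := fun x => (hf x).ofReal_comp
  have mem : ∀ {G : ℝ → ℂ}, Continuous G → MemLp G 2 (volume.restrict (Set.Ioc 0 L)) := by
    intro G hG
    obtain ⟨C, hC⟩ := (isCompact_Icc (a := (0 : ℝ)) (b := L)).exists_bound_of_continuousOn
      hG.continuousOn
    refine MemLp.of_bound hG.aestronglyMeasurable C ?_
    refine (ae_restrict_iff' measurableSet_Ioc).2 (ae_of_all _ fun x hx => ?_)
    exact hC x (Set.Ioc_subset_Icc_self hx)
  have P := hasSum_sq_fourierCoeffOn hL (mem cF)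
  have P' := hasSum_sq_fourierCoeffOn hL (mem cF')
  have kpos : 0 < 2 * Real.pi / L := by positivity
  -- Integration by parts; periodicity removes the boundary term.
  have key : ∀ n : ℤ, n ≠ 0 → ‖fourierCoeffOn hL F' n‖ = |(n : ℝ)| * (2 * Real.pi / L) *
      ‖fourierCoeffOn hL F n‖ := by
    intro n hn
    have h := fourierCoeffOn_of_hasDerivAt hL hn (fun x _ => dF x)
      (cF'.intervalIntegrable _ _)
    have hFL : F L - F 0 = 0 := by simp [hF, hper]
    rw [hFL, mul_zero, zero_sub] at h
    have hn' : |(n : ℝ)| ≠ 0 := by simpa using hn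
    rw [h]
    simp [abs_of_pos Real.pi_pos, abs_of_pos hL]
    field_simp
  have zero_of : ∀ n : ℤ, (∫ x in (0 : ℝ)..L, f x * Real.cos (2 * Real.pi / L * (n * x)) = 0) →
      (∫ x in (0 : ℝ)..L, f x * Real.sin (2 * Real.pi / L * (n * x)) = 0) →
      fourierCoeffOn hL F n = 0 := by
    intro n h1 h2
    rw [fourierCoeffOn_eq_integral]
    have : ∀ x : ℝ, (fourier (-n) (x : AddCircle (L - 0))) • F x =
        ((f x * Real.cos (2 * Real.pi / L * (n * x)) : ℝ) : ℂ) -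
        ((f x * Real.sin (2 * Real.pi / L * (n * x)) : ℝ) : ℂ) * Complex.I := by
      intro x
      rw [fourier_coe_apply, smul_eq_mul]
      have e : 2 * (Real.pi : ℂ) * Complex.I * ((-n : ℤ) : ℂ) * x / ((L - 0 : ℝ) : ℂ) =
          ((-(2 * Real.pi / L * (n * x)) : ℝ) : ℂ) * Complex.I := by
        push_cast; rw [sub_zero]; ring
      rw [e, Complex.exp_mul_I, ← Complex.ofReal_cos, ← Complex.ofReal_sin, Real.cos_neg,
        Real.sin_neg]
      push_cast; ring
    simp_rw [this]
    rw [intervalIntegral.integral_sub, intervalIntegral.integral_mul_const,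
      intervalIntegral.integral_ofReal, intervalIntegral.integral_ofReal, h1, h2]
    · simp
    · exact (by fun_prop : Continuous _).intervalIntegrable _ _
    · exact (by fun_prop : Continuous _).intervalIntegrable _ _
  have le : ∀ n : ℤ, (4 * (2 * Real.pi / L) ^ 2) * ‖fourierCoeffOn hL F n‖ ^ 2 ≤
      ‖fourierCoeffOn hL F' n‖ ^ 2 := by
    intro n
    by_cases hn : 2 ≤ |n|
    · have hn0 : n ≠ 0 := by rintro rfl; simp at hn
      rw [key n hn0]
      have h2 : (2 : ℝ) ≤ |(n : ℝ)| := by exact_mod_cast hn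
      have : 2 * (2 * Real.pi / L) * ‖fourierCoeffOn hL F n‖ ≤
          |(n : ℝ)| * (2 * Real.pi / L) * ‖fourierCoeffOn hL F n‖ := by gcongr
      calc _ = (2 * (2 * Real.pi / L) * ‖fourierCoeffOn hL F n‖) ^ 2 := by ring
        _ ≤ _ := by gcongr
    · have : fourierCoeffOn hL F n = 0 := by
        have hn3 : n = -1 ∨ n = 0 ∨ n = 1 := by
          have := abs_lt.1 (not_le.1 hn); omega
        rcases hn3 with rfl | rfl | rfl
        · apply zero_of
          · simpa using hc
          · simpa using hs
        · apply zero_of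
          · simpa using h0
          · simp
        · apply zero_of
          · simpa using hc
          · simpa using hs
      rw [this]; simp
  -- Parseval on both sides, compared mode by mode; the common factor 1/L is cancelled at the end.
  have := hasSum_le le (P.mul_left _) P'
  simp only [hF, hF', Complex.norm_real, Real.norm_eq_abs, sq_abs, sub_zero, smul_eq_mul] at this
  have hLi : 0 < L⁻¹ := by positivity
  nlinarith

/-! ### Lower bound for the energy of nearby rods -/

namespace ElasticRod

/-- Here ζ stands for z' and y for z'/√(1 - z²). Expand around Ω = k, u = m and discard β(u - m)².
What remains, multiplied by α, is the square (α(Ω - k) + βmz)² plus z²(α²(4k² - Ω²) - (βm)²), and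
the last bracket is nonnegative by `hδ` and `h3`. The terms on the left of the inequality are those
whose integrals are known or controlled by Wirtinger's inequality. -/
theorem energy_density_lower_bound {α β m k δ z ζ y Ω u : ℝ} (hα : 0 < α) (hβ : 0 ≤ β)
    (hδ : (β * m) ^ 2 ≤ α ^ 2 * (4 * k ^ 2 - (k + δ) ^ 2)) (h1 : ζ ^ 2 ≤ y ^ 2)
    (h3 : Ω ^ 2 ≤ (k + δ) ^ 2) :
    (α * k ^ 2 + β * m ^ 2) + (2 * α * k) * (Ω - k) + (2 * β * m) * ((u - z * Ω) - m) +
      (2 * β * m * k) * z + α * (ζ ^ 2 - 4 * k ^ 2 * z ^ 2) ≤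
      α * ((1 - z ^ 2) * Ω ^ 2 + y ^ 2) + β * u ^ 2 := by
  have h4 : 0 ≤ β * (u - m) ^ 2 := by positivity
  have h5 : 0 ≤ (α ^ 2 * (4 * k ^ 2 - (k + δ) ^ 2) - (β * m) ^ 2) * z ^ 2 :=
    mul_nonneg (sub_nonneg.2 hδ) (sq_nonneg _)
  have h6 : 0 ≤ α ^ 2 * (((k + δ) ^ 2 - Ω ^ 2) * z ^ 2) :=
    mul_nonneg (sq_nonneg _) (mul_nonneg (sub_nonneg.2 h3) (sq_nonneg _))
  have h7 := mul_le_mul_of_nonneg_left h1 hα.le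
  have h8 : 0 ≤ α * (Ω - k) ^ 2 - α * (z ^ 2 * Ω ^ 2) + 4 * α * k ^ 2 * z ^ 2 +
      2 * β * m * (z * (Ω - k)) := by
    refine nonneg_of_mul_nonneg_right (a := α) ?_ hα
    have h9 := sq_nonneg (α * (Ω - k) + β * m * z)
    linarith
  linarith

namespace Rod

variable {L : ℝ} (Γ : Rod L)

/-- The energy of the once-covered circle with twist rate `m` is a lower bound for the energy of
rods with the same `Δψ` whose tangent indicatrix is a graph close to the equator orthogonal to
`e`, provided that the height `⟨T, e⟩` has no Fourier modes of order `±1`. -/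
theorem le_energy (hL : 0 < L) {α β m δ : ℝ} (hα : 0 < α) (hβ : 0 ≤ β) {e : E3}
    (he : inner ℝ e e = (1 : ℝ)) (hz : ∀ s, (inner ℝ (Γ.T s) e : ℝ) ^ 2 < 1)
    (hΩ : ∀ s, |inner ℝ e (cross (Γ.T s) (deriv Γ.T s)) / (1 - (inner ℝ (Γ.T s) e : ℝ) ^ 2)
      - 2 * Real.pi / L| ≤ δ) (hδk : δ < 2 * Real.pi / L)
    (hc : ∫ s in (0 : ℝ)..L, (inner ℝ (Γ.T s) e : ℝ) * Real.cos (2 * Real.pi / L * s) = 0)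
    (hs : ∫ s in (0 : ℝ)..L, (inner ℝ (Γ.T s) e : ℝ) * Real.sin (2 * Real.pi / L * s) = 0)
    (hδ : (β * m) ^ 2 ≤ α ^ 2 * (4 * (2 * Real.pi / L) ^ 2 - (2 * Real.pi / L + δ) ^ 2))
    (hψ : Γ.HasDeltaPsi (m * L)) :
    (α * (2 * Real.pi / L) ^ 2 + β * m ^ 2) * L ≤ energy α β Γ := by
  set k := 2 * Real.pi / L with hk
  have kL : k * L = 2 * Real.pi := by rw [hk]; field_simp
  have kpos : 0 < k := by positivity
  set z : ℝ → ℝ := fun s => inner ℝ (Γ.T s) e with hzdef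
  set z' : ℝ → ℝ := fun s => inner ℝ (deriv Γ.T s) e with hz'def
  set n : ℝ → ℝ := fun s => inner ℝ e (cross (Γ.T s) (deriv Γ.T s)) with hn
  set Ω : ℝ → ℝ := fun s => n s / (1 - z s ^ 2) with hΩdef
  set w : ℝ → ℝ := fun s => (Real.sqrt (1 - z s ^ 2))⁻¹ with hw
  have hz1 : ∀ s, 0 < 1 - z s ^ 2 := fun s => sub_pos.2 (hz s)
  have wpos : ∀ s, 0 < w s := fun s => inv_pos.2 (Real.sqrt_pos.2 (hz1 s))
  have wsq : ∀ s, w s ^ 2 = (1 - z s ^ 2)⁻¹ := fun s => by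
    simp only [hw]; rw [inv_pow, Real.sq_sqrt (hz1 s).le]
  have wz : ∀ s, w s ^ 2 * (1 - z s ^ 2) = 1 := fun s => by
    rw [wsq, inv_mul_cancel₀ (hz1 s).ne']
  have nΩ : ∀ s, w s ^ 2 * n s = Ω s := fun s => by
    rw [wsq]; simp only [hΩdef]; rw [div_eq_inv_mul]
  have sT := Γ.smooth_T
  have sz : ContDiff ℝ ∞ z := sT.inner ℝ contDiff_const
  have sw : ContDiff ℝ ∞ w := by
    refine ContDiff.inv ?_ fun s => (Real.sqrt_pos.2 (hz1 s)).ne'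
    exact ContDiff.sqrt (contDiff_const.sub (sz.pow 2)) fun s => (hz1 s).ne'
  have dz : ∀ s, HasDerivAt z (z' s) s := fun s => by
    refine ((Γ.hasDerivAt_T s).inner ℝ (hasDerivAt_const s e)).congr_deriv ?_
    rw [inner_zero_right, zero_add]
  have cz : Continuous z := sz.continuous
  have cz' : Continuous z' := Γ.smooth_deriv_T.continuous.inner continuous_const
  have dw : ∀ s, HasDerivAt w (deriv w s) s := fun s => (sw.differentiable (by simp) s).hasDerivAt
  -- E₁ is the unit azimuthal direction about e and E₂ the unit meridional one. V completes E₁ and e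
  -- to a frame, in which the rotation of E₁ measures the longitude.
  set E₁ : ℝ → E3 := fun s => w s • cross e (Γ.T s) with hE₁
  set E₂ : ℝ → E3 := fun s => w s • (e - z s • Γ.T s) with hE₂
  set V : ℝ → E3 := fun s => cross e (E₁ s) with hV
  have seT : ContDiff ℝ ∞ fun s => cross e (Γ.T s) := (crossL e).contDiff.comp sT
  have sE₁ : ContDiff ℝ ∞ E₁ := sw.smul seT
  have sE₂ : ContDiff ℝ ∞ E₂ := sw.smul (contDiff_const.sub (sz.smul sT))
  have sV : ContDiff ℝ ∞ V := (crossL e).contDiff.comp sE₁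
  have dE₁ : ∀ s, deriv E₁ s = w s • cross e (deriv Γ.T s) + deriv w s • cross e (Γ.T s) :=
    fun s => ((dw s).smul ((crossL e).hasFDerivAt.comp_hasDerivAt s (Γ.hasDerivAt_T s))).deriv
  have zc : ∀ s, inner ℝ e (Γ.T s) = z s := fun s => real_inner_comm _ _
  have E₁one : ∀ s, inner ℝ (E₁ s) (E₁ s) = (1 : ℝ) := fun s => by
    simp only [hE₁, inner_smul_left, inner_smul_right, inner_cross_cross, he, Γ.inner_T_T, zc,
      RCLike.conj_to_real]
    rw [show inner ℝ (Γ.T s) e = z s from rfl]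
    linear_combination wz s
  have hframe : ∀ s, IsFrame (E₁ s) (E₂ s) (Γ.T s) := by
    intro s
    have h12 : E₂ s = cross (Γ.T s) (E₁ s) := by
      simp only [hE₁, hE₂]
      rw [cross_smul_right, cross_cross_right, Γ.inner_T_T, one_smul]
    have hT1 : inner ℝ (Γ.T s) (E₁ s) = (0 : ℝ) := by
      simp only [hE₁, inner_smul_right]; rw [inner_cross_right_self, mul_zero]
    refine ⟨E₁one s, ?_, ?_, ?_⟩
    · rw [h12, inner_cross_cross, Γ.inner_T_T, E₁one, hT1]; ring
    · rw [h12, inner_cross_right_self]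
    · rw [h12, cross_cross_right, E₁one, real_inner_comm, hT1]; simp
  have eE₁ : ∀ s, inner ℝ e (E₁ s) = (0 : ℝ) := fun s => by
    simp only [hE₁, inner_smul_right]; rw [inner_cross_left_self, mul_zero]
  have hframe' : ∀ s, IsFrame (E₁ s) (V s) e := by
    intro s
    refine ⟨E₁one s, ?_, inner_cross_right_self _ _, ?_⟩
    · simp only [hV]; rw [inner_cross_cross, he, E₁one, eE₁]; ring
    · simp only [hV]; rw [cross_cross_right, E₁one, real_inner_comm, eE₁]; simp
  have n_eq : ∀ s, inner ℝ (deriv Γ.T s) (cross e (Γ.T s)) = n s := fun s => by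
    rw [inner_cross_cyclic]
  have n_eq' : ∀ s, inner ℝ (cross e (deriv Γ.T s)) (Γ.T s) = -n s := fun s => by
    rw [real_inner_comm, inner_cross_cyclic, cross_anticomm', inner_neg_right]
  have ha : ∀ s, inner ℝ (deriv Γ.T s) (E₁ s) = w s * n s := fun s => by
    simp only [hE₁, inner_smul_right]; rw [n_eq]
  have hb : ∀ s, inner ℝ (deriv Γ.T s) (E₂ s) = w s * z' s := fun s => by
    simp only [hE₂, inner_smul_right, inner_sub_right]; rw [Γ.inner_deriv_T_T]; ring
  have hρ : ∀ s, inner ℝ (deriv E₁ s) (E₂ s) = z s * Ω s := fun s => by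
    rw [dE₁]
    simp only [hE₂, inner_smul_right, inner_sub_right, inner_add_left, inner_smul_left,
      RCLike.conj_to_real]
    rw [n_eq', real_inner_comm e, real_inner_comm e, inner_cross_left_self,
      inner_cross_left_self, real_inner_comm (Γ.T s), inner_cross_right_self, ← nΩ]
    ring
  have hρ' : ∀ s, inner ℝ (deriv E₁ s) (V s) = Ω s := fun s => by
    rw [dE₁]
    simp only [hV, hE₁, inner_add_left, inner_smul_left, cross_smul_right, inner_smul_right,
      RCLike.conj_to_real]
    rw [inner_cross_cross, inner_cross_right_self, inner_cross_left_self, he, n_eq, ← nΩ]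
    ring
  have Ωk : ∀ s, |Ω s - k| ≤ δ := hΩ
  have Ωpos : ∀ s, 0 < Ω s := fun s => by linarith [(abs_le.1 (Ωk s)).1]
  have npos : ∀ s, 0 < n s := fun s => by
    have := Ωpos s
    rw [← nΩ] at this
    exact pos_of_mul_pos_right this (sq_nonneg _)
  have cΩ : Continuous Ω := by
    have : Continuous n := continuous_const.inner
      (crossL.continuous₂.comp (sT.continuous.prodMk Γ.smooth_deriv_T.continuous))
    exact this.div (continuous_const.sub (cz.pow 2)) fun s => (hz1 s).ne'
  have TL : Γ.T L = Γ.T 0 := by have := Γ.periodic_T 0; rwa [zero_add] at this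
  have zL : z L = z 0 := by simp only [hzdef, TL]
  have wL : w L = w 0 := by simp only [hw, zL]
  have E₁L : E₁ L = E₁ 0 := by simp only [hE₁, TL, wL]
  have E₂L : E₂ L = E₂ 0 := by simp only [hE₂, TL, wL, zL]
  -- the winding number around `e` is one
  have wind : ∫ s in (0 : ℝ)..L, (Ω s - k) = 0 := by
    obtain ⟨χ, -, dχ, hχ⟩ := exists_angle (E₁ := fun _ => E₁ 0) (E₂ := fun _ => V 0) hframe'
      (fun _ => hframe' 0) sE₁ sV contDiff_const contDiff_const
    have dχ' : ∀ s, HasDerivAt χ (Ω s) s := fun s => by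
      refine (dχ s).congr_deriv ?_
      rw [hρ', deriv_const, inner_zero_left, sub_zero]
    have hint := intervalIntegral.integral_eq_sub_of_hasDerivAt (a := 0) (b := L)
      (fun s _ => dχ' s) (cΩ.intervalIntegrable _ _)
    have h01 := (hχ L).symm.trans (E₁L.trans (hχ 0))
    have h1 := congrArg (fun v => (inner ℝ v (E₁ 0) : ℝ)) h01
    have h2 := congrArg (fun v => (inner ℝ v (V 0) : ℝ)) h01
    simp only [inner_add_left, inner_smul_left, (hframe' 0).one, (hframe' 0).two,
      (hframe' 0).orth, real_inner_comm (E₁ 0) (V 0), RCLike.conj_to_real, mul_one, mul_zero,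
      add_zero, zero_add] at h1 h2
    have h3 : Real.cos (χ L - χ 0) = 1 := by
      rw [Real.cos_sub, h1, h2]; linarith [Real.sin_sq_add_cos_sq (χ 0)]
    -- The total longitude is 2πN, and it differs from kL = 2π by at most δL < 2π, which leaves only
    -- N = 1.
    obtain ⟨N, hN⟩ := (Real.cos_eq_one_iff _).1 h3
    have hsub : ∫ s in (0 : ℝ)..L, (Ω s - k) = (N - 1) * (2 * Real.pi) := by
      rw [intervalIntegral.integral_sub (cΩ.intervalIntegrable _ _) (by simp), hint, ← hN]
      simp only [intervalIntegral.integral_const, smul_eq_mul, sub_zero]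
      linarith
    have hbd : |∫ s in (0 : ℝ)..L, (Ω s - k)| ≤ δ * |L - 0| := by
      rw [← Real.norm_eq_abs]
      exact intervalIntegral.norm_integral_le_of_norm_le_const fun s _ => Ωk s
    rw [hsub, sub_zero, abs_of_pos hL, abs_mul, abs_of_pos (by positivity : 0 < 2 * Real.pi)]
      at hbd
    have hlt : |(N : ℝ) - 1| * (2 * Real.pi) < 1 * (2 * Real.pi) := by nlinarith
    have hN1 : |(N : ℝ) - 1| < 1 := lt_of_mul_lt_mul_right hlt (by positivity)
    have : |N - 1| < 1 := by exact_mod_cast hN1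
    have : N = 1 := by have := abs_lt.1 this; omega
    rw [hsub, this]; simp
  have zint : ∫ s in (0 : ℝ)..L, z s = 0 := by
    have h := (innerSL ℝ e).intervalIntegral_comp_comm
      (sT.continuous.intervalIntegrable (μ := MeasureTheory.volume) 0 L)
    rw [Γ.integral_T, map_zero] at h
    refine Eq.trans ?_ h
    exact intervalIntegral.integral_congr fun s _ => (zc s).symm
  have twist : ∫ s in (0 : ℝ)..L, (Γ.u₃ s - z s * Ω s) = m * L := by
    have := (Γ.hasDeltaPsi_iff hL.le hframe sE₁ sE₂ E₁L E₂L
      (fun s => by rw [ha]; exact mul_pos (wpos s) (npos s)) _).1 hψ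
    rw [this]
    exact intervalIntegral.integral_congr fun s _ => by simp only [hρ]
  have wirt := wirtinger_of_modes_ge_two hL dz cz' zL zint hc hs
  have point : ∀ s, (α * k ^ 2 + β * m ^ 2) + (2 * α * k) * (Ω s - k) +
      (2 * β * m) * ((Γ.u₃ s - z s * Ω s) - m) + (2 * β * m * k) * z s +
      α * (z' s ^ 2 - 4 * k ^ 2 * z s ^ 2) ≤
      α * (Γ.u₁ s ^ 2 + Γ.u₂ s ^ 2) + β * Γ.u₃ s ^ 2 := by
    intro s
    rw [Γ.u₁_sq_add_u₂_sq (hframe s), ha, hb]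
    have h1 : z' s ^ 2 ≤ (w s * z' s) ^ 2 := by
      have h1w : 1 ≤ w s ^ 2 := by
        rw [wsq]; exact (one_le_inv₀ (hz1 s)).2 (by linarith [sq_nonneg (z s)])
      rw [mul_pow]; exact le_mul_of_one_le_left (sq_nonneg _) h1w
    have h2 : (w s * n s) ^ 2 = (1 - z s ^ 2) * Ω s ^ 2 := by
      rw [← nΩ]; linear_combination (- w s ^ 2 * n s ^ 2) * wz s
    have h3 : Ω s ^ 2 ≤ (k + δ) ^ 2 := by
      have := (abs_le.1 (Ωk s)).2
      have := Ωpos s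
      gcongr; linarith
    rw [h2]
    exact energy_density_lower_bound hα hβ hδ h1 h3
  have cu := Γ.continuous_u₃
  have hmono := intervalIntegral.integral_mono_on (μ := MeasureTheory.volume) hL.le
    ((by fun_prop : Continuous fun s => (α * k ^ 2 + β * m ^ 2) + (2 * α * k) * (Ω s - k) +
      (2 * β * m) * ((Γ.u₃ s - z s * Ω s) - m) + (2 * β * m * k) * z s +
      α * (z' s ^ 2 - 4 * k ^ 2 * z s ^ 2)).intervalIntegrable 0 L)
    ((Γ.continuous_energy_density α β).intervalIntegrable 0 L) (fun s _ => point s)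
  refine le_trans ?_ hmono
  have i1 : ∀ {f : ℝ → ℝ}, Continuous f → IntervalIntegrable f MeasureTheory.volume 0 L :=
    fun hf => hf.intervalIntegrable 0 L
  rw [intervalIntegral.integral_add (i1 (by fun_prop)) (i1 (by fun_prop)),
    intervalIntegral.integral_add (i1 (by fun_prop)) (i1 (by fun_prop)),
    intervalIntegral.integral_add (i1 (by fun_prop)) (i1 (by fun_prop)),
    intervalIntegral.integral_add (i1 (by fun_prop)) (i1 (by fun_prop)),
    intervalIntegral.integral_const_mul, intervalIntegral.integral_const_mul,
    intervalIntegral.integral_const_mul, intervalIntegral.integral_const_mul, wind, zint,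
    intervalIntegral.integral_sub (i1 (by fun_prop)) (i1 (by fun_prop)), twist,
    intervalIntegral.integral_sub (i1 (by fun_prop)) (i1 (by fun_prop)),
    intervalIntegral.integral_const_mul]
  simp only [intervalIntegral.integral_const, smul_eq_mul, sub_zero]
  have := mul_nonneg hα.le (sub_nonneg.2 wirt)
  nlinarith

end Rod

end ElasticRod

/-! ### The circular rod and its stability under small twist -/

namespace ElasticRod

namespace Rod

variable {L : ℝ} {Γ : Rod L}

theorem HasCircularCenterline.exists_frame (hL : 0 < L) (h : Γ.HasCircularCenterline) :
    ∃ e₁ e₂ e₃ : E3, IsFrame e₁ e₂ e₃ ∧ ∀ s, Γ.T s =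
      (-Real.sin (2 * Real.pi / L * s)) • e₁ + Real.cos (2 * Real.pi / L * s) • e₂ := by
  obtain ⟨c, e₁, e₂, R, ho, hR, hγ⟩ := h
  have hpi := Real.pi_pos
  have hR0 : R ≠ 0 := by rintro rfl; simp at hR; exact hL.ne hR
  refine ⟨e₁, e₂, _, ⟨?_, ?_, ?_, rfl⟩, fun s => ?_⟩
  · have := ho.1 0
    rw [real_inner_self_eq_norm_sq]; simp at this; simp [this]
  · have := ho.1 1
    rw [real_inner_self_eq_norm_sq]; simp at this; simp [this]
  · have := ho.2 (i := 0) (j := 1) (by simp)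
    simpa using this
  · have hk : ∀ s, 2 * Real.pi / L * s = s / R := fun s => by rw [← hR]; field_simp
    have d1 : HasDerivAt (fun s => s / R) (1 / R) s := (hasDerivAt_id s).div_const R
    have d2 := (((d1.cos.const_mul R).smul_const e₁).const_add c).add
      ((d1.sin.const_mul R).smul_const e₂)
    have d3 := d2.congr_of_eventuallyEq (f₁ := Γ.γ) (Filter.Eventually.of_forall hγ)
    rw [hk, (Γ.hasDerivAt_γ s).unique d3]
    congr 2 <;> field_simp

section Circle

variable {e₁ e₂ e₃ : E3}

theorem deriv_T_of_circle (hT : ∀ s, Γ.T s =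
    (-Real.sin (2 * Real.pi / L * s)) • e₁ + Real.cos (2 * Real.pi / L * s) • e₂) (s : ℝ) :
    deriv Γ.T s = (2 * Real.pi / L) • ((-Real.cos (2 * Real.pi / L * s)) • e₁ +
      (-Real.sin (2 * Real.pi / L * s)) • e₂) := by
  have d1 : HasDerivAt (fun s => 2 * Real.pi / L * s) (2 * Real.pi / L * 1) s :=
    (hasDerivAt_id s).const_mul _
  have d2 := (d1.sin.neg.smul_const e₁).add (d1.cos.smul_const e₂)
  rw [show Γ.T = _ from funext hT]
  refine d2.deriv.trans ?_
  module

theorem isFrame_of_circle (he : IsFrame e₁ e₂ e₃) (hT : ∀ s, Γ.T s =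
    (-Real.sin (2 * Real.pi / L * s)) • e₁ + Real.cos (2 * Real.pi / L * s) • e₂) (s : ℝ) :
    IsFrame ((-Real.cos (2 * Real.pi / L * s)) • e₁ + (-Real.sin (2 * Real.pi / L * s)) • e₂) e₃
      (Γ.T s) := by
  refine ⟨?_, he.three, ?_, ?_⟩
  · simp only [inner_add_left, inner_add_right, inner_smul_left, inner_smul_right, he.one, he.two,
      he.orth, real_inner_comm e₁ e₂, RCLike.conj_to_real]
    linarith [Real.sin_sq_add_cos_sq (2 * Real.pi / L * s)]
  · simp only [inner_add_left, inner_smul_left, he.orth₁₃, he.orth₂₃]; simp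
  · rw [hT, cross_add_left, cross_smul_left, cross_smul_left, he.cross₂₃, cross_anticomm',
      he.cross₃₁]
    module

theorem hasDeltaPsi_circle_iff (hL : 0 < L) (he : IsFrame e₁ e₂ e₃) (hT : ∀ s, Γ.T s =
    (-Real.sin (2 * Real.pi / L * s)) • e₁ + Real.cos (2 * Real.pi / L * s) • e₂) {m : ℝ}
    (hm : Γ.HasConstantTwistRate m) (d : ℝ) : Γ.HasDeltaPsi d ↔ d = m * L := by
  have hf := isFrame_of_circle he hT
  have kL : 2 * Real.pi / L * L = 2 * Real.pi := by field_simp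
  have hpi := Real.pi_pos
  have d1 : ∀ s, HasDerivAt (fun s => 2 * Real.pi / L * s) (2 * Real.pi / L * 1) s :=
    fun s => (hasDerivAt_id s).const_mul _
  rw [Γ.hasDeltaPsi_iff hL.le hf (by fun_prop) contDiff_const (by simp [kL]) rfl
    (fun s => by
      rw [deriv_T_of_circle hT, inner_smul_left, (hf s).one]; simp; positivity)]
  have : ∫ s in (0 : ℝ)..L, (Γ.u₃ s - inner ℝ (deriv (fun s =>
      (-Real.cos (2 * Real.pi / L * s)) • e₁ + (-Real.sin (2 * Real.pi / L * s)) • e₂) s) e₃) =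
      ∫ s in (0 : ℝ)..L, m := by
    refine intervalIntegral.integral_congr fun s hs => ?_
    rw [Set.uIcc_of_le hL.le] at hs
    beta_reduce
    have d2 : HasDerivAt (fun s => (-Real.cos (2 * Real.pi / L * s)) • e₁ +
        (-Real.sin (2 * Real.pi / L * s)) • e₂) _ s :=
      ((d1 s).cos.neg.smul_const e₁).add ((d1 s).sin.neg.smul_const e₂)
    rw [d2.deriv, hm s hs,
      inner_add_left, inner_smul_left, inner_smul_left, he.orth₁₃, he.orth₂₃]
    simp
  rw [this]
  simp [mul_comm]

theorem energy_circle (hL : 0 < L) (he : IsFrame e₁ e₂ e₃) (hT : ∀ s, Γ.T s =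
    (-Real.sin (2 * Real.pi / L * s)) • e₁ + Real.cos (2 * Real.pi / L * s) • e₂) {m : ℝ}
    (hm : Γ.HasConstantTwistRate m) (α β : ℝ) :
    energy α β Γ = (α * (2 * Real.pi / L) ^ 2 + β * m ^ 2) * L := by
  have hf := isFrame_of_circle he hT
  have : energy α β Γ = ∫ s in (0 : ℝ)..L, (α * (2 * Real.pi / L) ^ 2 + β * m ^ 2) := by
    refine intervalIntegral.integral_congr fun s hs => ?_
    rw [Set.uIcc_of_le hL.le] at hs
    rw [Γ.u₁_sq_add_u₂_sq (hf s), hm s hs, deriv_T_of_circle hT, inner_smul_left,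
      inner_smul_left, (hf s).one, (hf s).orth]
    simp
  rw [this, intervalIntegral.integral_const, smul_eq_mul, sub_zero, mul_comm]

end Circle

theorem isStable_of_small_twist {α β m : ℝ} (hL : 0 < L) (hα : 0 < α) (hβ : 0 ≤ β)
    (hcirc : Γ.HasCircularCenterline) (hm : Γ.HasConstantTwistRate m) {r : ℕ} (hr : 1 ≤ r)
    (hsmall : (β * m) ^ 2 < 3 * (α * (2 * Real.pi / L)) ^ 2) : Γ.IsStable α β r := by
  obtain ⟨e₁, e₂, e₃, he, hT⟩ := hcirc.exists_frame hL
  have hf := isFrame_of_circle he hT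
  have hT' := deriv_T_of_circle hT
  have hd := hasDeltaPsi_circle_iff hL he hT hm
  have hE := energy_circle hL he hT hm α β
  set k := 2 * Real.pi / L with hk
  have hpi := Real.pi_pos
  have kpos : 0 < k := by positivity
  have kL : k * L = 2 * Real.pi := by rw [hk]; field_simp
  obtain ⟨δ, δpos, δk, hδ⟩ : ∃ δ > 0, δ < k ∧
      (β * m) ^ 2 ≤ α ^ 2 * (4 * k ^ 2 - (k + δ) ^ 2) := by
    have hη : 0 < 3 * (α * k) ^ 2 - (β * m) ^ 2 := sub_pos.2 hsmall
    set η := 3 * (α * k) ^ 2 - (β * m) ^ 2 with hηdef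
    -- The requirement is α²(2kδ + δ²) ≤ η. As δ ≤ k, the left side is at most 3α²kδ.
    refine ⟨min (k / 2) (η / (3 * α ^ 2 * k)), lt_min (by positivity) (by positivity),
      (min_le_left _ _).trans_lt (by linarith), ?_⟩
    set δ := min (k / 2) (η / (3 * α ^ 2 * k)) with hδ
    have δ0 : 0 < δ := lt_min (by positivity) (by positivity)
    have h1 : δ ≤ k / 2 := min_le_left _ _
    have h2 : δ * (3 * α ^ 2 * k) ≤ η := by
      have : δ ≤ η / (3 * α ^ 2 * k) := min_le_right _ _
      rwa [le_div_iff₀ (by positivity)] at this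
    have h3 : α ^ 2 * (δ * δ) ≤ α ^ 2 * (δ * k) := by gcongr; linarith
    linarith
  -- uniform estimates near the circle
  set U : Set (E3 × E3 × E3) := {p | (inner ℝ p.1 p.2.2 : ℝ) ^ 2 < 1 ∧
    |inner ℝ p.2.2 (cross p.1 p.2.1) - k * (1 - (inner ℝ p.1 p.2.2 : ℝ) ^ 2)| <
      δ * (1 - (inner ℝ p.1 p.2.2 : ℝ) ^ 2)} with hU
  have oU : IsOpen U := by
    have c1 : Continuous fun p : E3 × E3 × E3 => cross p.1 p.2.1 :=
      crossL.continuous₂.comp (continuous_fst.prodMk (continuous_fst.comp continuous_snd))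
    have o1 : IsOpen {p : E3 × E3 × E3 | (inner ℝ p.1 p.2.2 : ℝ) ^ 2 < 1} :=
      isOpen_lt (by fun_prop) (by fun_prop)
    have o2 : IsOpen {p : E3 × E3 × E3 | |inner ℝ p.2.2 (cross p.1 p.2.1) -
        k * (1 - (inner ℝ p.1 p.2.2 : ℝ) ^ 2)| < δ * (1 - (inner ℝ p.1 p.2.2 : ℝ) ^ 2)} :=
      isOpen_lt (by fun_prop) (by fun_prop)
    exact o1.inter o2
  set K : Set (E3 × E3 × E3) := (fun s => (Γ.T s, deriv Γ.T s, e₃)) '' Set.Icc 0 L with hK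
  have cK : IsCompact K := isCompact_Icc.image
    (Γ.smooth_T.continuous.prodMk (Γ.smooth_deriv_T.continuous.prodMk continuous_const))
  have T3 : ∀ s, inner ℝ (Γ.T s) e₃ = (0 : ℝ) := fun s => by
    rw [real_inner_comm]; exact (hf s).orth₂₃
  have KU : K ⊆ U := by
    rintro _ ⟨s, -, rfl⟩
    have : inner ℝ e₃ (cross (Γ.T s) (deriv Γ.T s)) = k := by
      rw [hT', cross_smul_right, (hf s).cross₃₁, inner_smul_right, he.three, mul_one]
    simp [hU, T3, this, δpos]
  obtain ⟨δ₂, δ₂pos, hδ₂⟩ := cK.exists_thickening_subset_open oU KU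
  -- Selects the axis: a unit vector normal to the cosine and sine coefficients of T, which kills
  -- the modes ±1 of the height.
  set Φ : E3 × E3 → E3 := fun p => ‖cross p.1 p.2‖⁻¹ • cross p.1 p.2 with hΦ
  set A : Rod L → E3 := fun Γ' => ∫ s in (0 : ℝ)..L, Real.cos (k * s) • Γ'.T s with hA
  set B : Rod L → E3 := fun Γ' => ∫ s in (0 : ℝ)..L, Real.sin (k * s) • Γ'.T s with hB
  have icc : ∀ {f : ℝ → E3}, Continuous f → IntervalIntegrable f MeasureTheory.volume 0 L :=
    fun hf => hf.intervalIntegrable 0 L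
  have icr : ∀ {f : ℝ → ℝ}, Continuous f → IntervalIntegrable f MeasureTheory.volume 0 L :=
    fun hf => hf.intervalIntegrable 0 L
  have dks : ∀ s, HasDerivAt (fun s => k * s) k s := fun s => by
    simpa using (hasDerivAt_id s).const_mul k
  have scs : Real.cos (k * L) = 1 ∧ Real.sin (k * L) = 0 := by rw [kL]; simp
  have Isc : ∫ s in (0 : ℝ)..L, Real.sin (k * s) * Real.cos (k * s) = 0 := by
    rw [intervalIntegral.integral_eq_sub_of_hasDerivAt
      (f := fun s => Real.sin (k * s) ^ 2 / (2 * k))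
      (fun s _ => (((dks s).sin.pow 2).div_const (2 * k)).congr_deriv (by simp; field_simp))
      (icr (by fun_prop))]
    simp [scs]
  have Icc' : ∫ s in (0 : ℝ)..L, Real.cos (k * s) ^ 2 = L / 2 := by
    rw [intervalIntegral.integral_eq_sub_of_hasDerivAt
      (f := fun s => s / 2 + Real.sin (k * s) * Real.cos (k * s) / (2 * k))
      (fun s _ => (((hasDerivAt_id s).div_const 2).add
        (((dks s).sin.mul (dks s).cos).div_const (2 * k))).congr_deriv (by
          field_simp; linarith [Real.sin_sq_add_cos_sq (k * s)]))
      (icr (by fun_prop))]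
    simp [scs]
  have Iss : ∫ s in (0 : ℝ)..L, Real.sin (k * s) ^ 2 = L / 2 := by
    have : ∀ s, Real.sin (k * s) ^ 2 = 1 - Real.cos (k * s) ^ 2 := fun s => by
      linarith [Real.sin_sq_add_cos_sq (k * s)]
    simp_rw [this]
    rw [intervalIntegral.integral_sub (icr (by fun_prop)) (icr (by fun_prop)), Icc']
    simp; ring
  have A0 : A Γ = (L / 2) • e₂ := by
    have : ∀ s, Real.cos (k * s) • Γ.T s = (-(Real.sin (k * s) * Real.cos (k * s))) • e₁ +
        (Real.cos (k * s) ^ 2) • e₂ := fun s => by rw [hT]; module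
    simp only [hA, this]
    rw [intervalIntegral.integral_add (icc (by fun_prop)) (icc (by fun_prop)),
      intervalIntegral.integral_smul_const, intervalIntegral.integral_smul_const,
      intervalIntegral.integral_neg, Isc, Icc']
    simp
  have B0 : B Γ = (-(L / 2)) • e₁ := by
    have : ∀ s, Real.sin (k * s) • Γ.T s = (-(Real.sin (k * s) ^ 2)) • e₁ +
        (Real.sin (k * s) * Real.cos (k * s)) • e₂ := fun s => by rw [hT]; module
    simp only [hB, this]
    rw [intervalIntegral.integral_add (icc (by fun_prop)) (icc (by fun_prop)),
      intervalIntegral.integral_smul_const, intervalIntegral.integral_smul_const,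
      intervalIntegral.integral_neg, Isc, Iss]
    simp
  have AB0 : cross (A Γ) (B Γ) = (L / 2 * (L / 2)) • e₃ := by
    rw [A0, B0, cross_smul_left, cross_smul_right, cross_anticomm', he.cross_eq]; module
  have e₃norm : ‖e₃‖ = 1 := by
    rw [← sq_eq_sq₀ (norm_nonneg _) zero_le_one, ← real_inner_self_eq_norm_sq, he.three, one_pow]
  have Φ0 : Φ (A Γ, B Γ) = e₃ := by
    simp only [hΦ, AB0, norm_smul, e₃norm, mul_one, smul_smul]
    rw [Real.norm_of_nonneg (by positivity), inv_mul_cancel₀ (by positivity), one_smul]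
  have cΦ : ContinuousAt Φ (A Γ, B Γ) := by
    have c1 : Continuous fun p : E3 × E3 => cross p.1 p.2 := crossL.continuous₂
    refine (c1.continuousAt.norm.inv₀ ?_).smul c1.continuousAt
    rw [AB0, norm_smul, e₃norm, mul_one, norm_ne_zero_iff]
    positivity
  -- The bound 1 guards against a vanishing product: then Φ would be 0, at distance exactly 1 from
  -- `e₃`.
  obtain ⟨δ₃, δ₃pos, hδ₃⟩ := Metric.continuousAt_iff.1 cΦ (min δ₂ 1) (by positivity)
  rw [Φ0] at hδ₃
  refine ⟨min δ₂ (δ₃ / (L + 1)), by positivity, ?_⟩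
  rintro Γ' ⟨d, hd1, hd2⟩ hclose
  rw [hd] at hd1
  rw [hd1] at hd2
  have hclT : ∀ s ∈ Set.Icc 0 L, ‖Γ'.T s - Γ.T s‖ < min δ₂ (δ₃ / (L + 1)) := fun s hs => by
    simpa using ((hclose s hs).2 0 (Nat.zero_le r)).1
  have hclT' : ∀ s ∈ Set.Icc 0 L, ‖deriv Γ'.T s - deriv Γ.T s‖ < min δ₂ (δ₃ / (L + 1)) :=
    fun s hs => by simpa using ((hclose s hs).2 1 hr).1
  have hcoef : ∀ f : ℝ → ℝ, Continuous f → (∀ s, |f s| ≤ 1) →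
      dist (∫ s in (0 : ℝ)..L, f s • Γ'.T s) (∫ s in (0 : ℝ)..L, f s • Γ.T s) < δ₃ := by
    intro f cf hf1
    have cT := Γ.smooth_T.continuous
    have cT' := Γ'.smooth_T.continuous
    rw [dist_eq_norm, ← intervalIntegral.integral_sub (icc (by fun_prop)) (icc (by fun_prop))]
    have : ‖∫ s in (0 : ℝ)..L, (f s • Γ'.T s - f s • Γ.T s)‖ ≤ δ₃ / (L + 1) * |L - 0| := by
      refine intervalIntegral.norm_integral_le_of_norm_le_const fun s hs => ?_
      rw [Set.uIoc_of_le hL.le] at hs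
      rw [← smul_sub, norm_smul, Real.norm_eq_abs]
      have h1 := (hclT s (Set.Ioc_subset_Icc_self hs)).le.trans (min_le_right _ _)
      calc |f s| * ‖Γ'.T s - Γ.T s‖ ≤ 1 * (δ₃ / (L + 1)) := by gcongr; exact hf1 s
        _ = _ := one_mul _
    refine this.trans_lt ?_
    rw [sub_zero, abs_of_pos hL, div_mul_eq_mul_div, div_lt_iff₀ (by positivity)]
    nlinarith
  have hAB : dist (A Γ', B Γ') (A Γ, B Γ) < δ₃ := by
    rw [Prod.dist_eq]
    exact max_lt (hcoef _ (by fun_prop) fun s => Real.abs_cos_le_one _)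
      (hcoef _ (by fun_prop) fun s => Real.abs_sin_le_one _)
  have hΦe := hδ₃ hAB
  set e := Φ (A Γ', B Γ') with hedef
  have heq : e = ‖cross (A Γ') (B Γ')‖⁻¹ • cross (A Γ') (B Γ') := rfl
  have hne : cross (A Γ') (B Γ') ≠ 0 := by
    intro h0
    have : e = 0 := by rw [heq, h0, smul_zero]
    rw [this, dist_eq_norm, zero_sub, norm_neg, e₃norm] at hΦe
    exact absurd (hΦe.trans_le (min_le_right _ _)) (lt_irrefl _)
  have hee : inner ℝ e e = (1 : ℝ) := by
    have : ‖cross (A Γ') (B Γ')‖ ≠ 0 := norm_ne_zero_iff.2 hne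
    rw [real_inner_self_eq_norm_sq, heq, norm_smul, norm_inv, norm_norm, inv_mul_cancel₀ this,
      one_pow]
  -- Closeness is known only on [0, L]; periodicity of the tangent extends the estimates to all s.
  have hUall : ∀ s, (Γ'.T s, deriv Γ'.T s, e) ∈ U := by
    have hper : Function.Periodic (fun s => (Γ'.T s, deriv Γ'.T s, e)) L := fun s => by
      simp only [Γ'.periodic_T s, Γ'.periodic_deriv_T s]
    intro s
    obtain ⟨s', hs', hss⟩ := hper.exists_mem_Ico₀ hL s
    beta_reduce at hss
    rw [hss]
    have hs'' := Set.Ico_subset_Icc_self hs'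
    refine hδ₂ (Metric.mem_thickening_iff.2 ⟨_, ⟨s', hs'', rfl⟩, ?_⟩)
    rw [Prod.dist_eq, Prod.dist_eq, dist_eq_norm, dist_eq_norm]
    exact max_lt ((hclT s' hs'').trans_le (min_le_left _ _))
      (max_lt ((hclT' s' hs'').trans_le (min_le_left _ _)) (hΦe.trans_le (min_le_left _ _)))
  have hmode : ∀ f : ℝ → ℝ, Continuous f → inner ℝ e (∫ s in (0 : ℝ)..L, f s • Γ'.T s) = (0 : ℝ) →
      ∫ s in (0 : ℝ)..L, (inner ℝ (Γ'.T s) e : ℝ) * f s = 0 := by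
    intro f cf h0
    have cT' := Γ'.smooth_T.continuous
    have h := (innerSL ℝ e).intervalIntegral_comp_comm
      (icc (by fun_prop : Continuous fun s => f s • Γ'.T s))
    refine Eq.trans ?_ (h.trans h0)
    refine intervalIntegral.integral_congr fun s _ => ?_
    simp only [innerSL_apply_apply, inner_smul_right]
    rw [real_inner_comm, mul_comm]
  rw [hE]
  refine Γ'.le_energy hL hα hβ hee (fun s => (hUall s).1) (fun s => ?_) δk
    (hmode _ (by fun_prop) ?_) (hmode _ (by fun_prop) ?_) hδ hd2
  · obtain ⟨h1, h2⟩ := hUall s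
    beta_reduce at h1 h2
    have h3 := sub_pos.2 h1
    rw [← hk, ← mul_le_mul_iff_left₀ h3, ← abs_of_pos h3, ← abs_mul, abs_of_pos h3, sub_mul,
      div_mul_cancel₀ _ h3.ne']
    exact h2.le
  · change inner ℝ e (A Γ') = (0 : ℝ)
    rw [heq, inner_smul_left, real_inner_comm, inner_cross_left_self, mul_zero]
  · change inner ℝ e (B Γ') = (0 : ℝ)
    rw [heq, inner_smul_left, real_inner_comm, inner_cross_right_self, mul_zero]

end Rod

end ElasticRod

/-! ### Spherical frames and smooth families of curves -/

namespace ElasticRod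

namespace IsFrame

variable {a b c : E3}

theorem rotate_left (h : IsFrame a b c) (y : ℝ) :
    IsFrame a (Real.cos y • b - Real.sin y • c) (Real.cos y • c + Real.sin y • b) := by
  refine ⟨h.one, ?_, ?_, ?_⟩
  · simp only [inner_sub_left, inner_sub_right, inner_smul_left, inner_smul_right, h.two, h.three,
      h.orth₂₃, real_inner_comm b c, RCLike.conj_to_real]
    linarith [Real.sin_sq_add_cos_sq y]
  · simp only [inner_sub_right, inner_smul_right, h.orth, h.orth₁₃]; ring
  · rw [cross_sub_right, cross_smul_right, cross_smul_right, h.cross_eq, cross_anticomm' a c,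
      h.cross₃₁]
    module

theorem rotate_right (h : IsFrame a b c) (y : ℝ) :
    IsFrame (Real.cos y • a + Real.sin y • b) (Real.cos y • b - Real.sin y • a) c := by
  have h1 := (h.rotate.rotate.rotate_left (-y)).rotate
  simpa only [Real.cos_neg, Real.sin_neg, neg_smul, sub_neg_eq_add, ← sub_eq_add_neg] using h1

end IsFrame

/-- Unit vector of the plane of `e₁, e₂` with longitude `x`, measured from `e₂`. -/
noncomputable def radial (e₁ e₂ : E3) (x : ℝ) : E3 := (-Real.sin x) • e₁ + Real.cos x • e₂

/-- Derivative of `radial` with respect to the longitude. -/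
noncomputable def azimuthal (e₁ e₂ : E3) (x : ℝ) : E3 := (-Real.cos x) • e₁ + (-Real.sin x) • e₂

/-- Point of the unit sphere with longitude `x` and latitude `y`. -/
noncomputable def spherical (e₁ e₂ e₃ : E3) (x y : ℝ) : E3 := Real.cos y • radial e₁ e₂ x + Real.sin y • e₃

/-- Derivative of `spherical` with respect to the latitude. -/
noncomputable def meridional (e₁ e₂ e₃ : E3) (x y : ℝ) : E3 := Real.cos y • e₃ - Real.sin y • radial e₁ e₂ x

/-- First vector of the spherical frame turned by the angle `t`. -/
noncomputable def turned₁ (e₁ e₂ e₃ : E3) (x y t : ℝ) : E3 :=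
  Real.cos t • azimuthal e₁ e₂ x + Real.sin t • meridional e₁ e₂ e₃ x y

/-- Second vector of the spherical frame turned by the angle `t`. -/
noncomputable def turned₂ (e₁ e₂ e₃ : E3) (x y t : ℝ) : E3 :=
  Real.cos t • meridional e₁ e₂ e₃ x y - Real.sin t • azimuthal e₁ e₂ x

section Spherical

variable {e₁ e₂ e₃ : E3}

theorem isFrame_azimuthal (he : IsFrame e₁ e₂ e₃) (x : ℝ) :
    IsFrame (azimuthal e₁ e₂ x) e₃ (radial e₁ e₂ x) := by
  refine ⟨?_, he.three, ?_, ?_⟩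
  · simp only [azimuthal, inner_add_left, inner_add_right, inner_smul_left, inner_smul_right,
      he.one, he.two, he.orth, real_inner_comm e₁ e₂, RCLike.conj_to_real]
    linarith [Real.sin_sq_add_cos_sq x]
  · simp only [azimuthal, inner_add_left, inner_smul_left, he.orth₁₃, he.orth₂₃]; simp
  · rw [azimuthal, radial, cross_add_left, cross_smul_left, cross_smul_left, he.cross₂₃,
      cross_anticomm' e₁, he.cross₃₁]
    module

theorem isFrame_spherical (he : IsFrame e₁ e₂ e₃) (x y : ℝ) :
    IsFrame (azimuthal e₁ e₂ x) (meridional e₁ e₂ e₃ x y) (spherical e₁ e₂ e₃ x y) :=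
  (isFrame_azimuthal he x).rotate_left y

theorem isFrame_turned (he : IsFrame e₁ e₂ e₃) (x y t : ℝ) :
    IsFrame (turned₁ e₁ e₂ e₃ x y t) (turned₂ e₁ e₂ e₃ x y t) (spherical e₁ e₂ e₃ x y) :=
  (isFrame_spherical he x y).rotate_right t

variable {x y t : ℝ → ℝ} {x' y' t' s : ℝ}

theorem hasDerivAt_radial (hx : HasDerivAt x x' s) :
    HasDerivAt (fun s => radial e₁ e₂ (x s)) (x' • azimuthal e₁ e₂ (x s)) s := by
  refine ((hx.sin.neg.smul_const e₁).add (hx.cos.smul_const e₂)).congr_deriv ?_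
  rw [azimuthal]; module

theorem hasDerivAt_azimuthal (hx : HasDerivAt x x' s) :
    HasDerivAt (fun s => azimuthal e₁ e₂ (x s)) (-x' • radial e₁ e₂ (x s)) s := by
  refine ((hx.cos.neg.smul_const e₁).add (hx.sin.neg.smul_const e₂)).congr_deriv ?_
  rw [radial]; module

theorem hasDerivAt_spherical (hx : HasDerivAt x x' s) (hy : HasDerivAt y y' s) :
    HasDerivAt (fun s => spherical e₁ e₂ e₃ (x s) (y s))
      ((Real.cos (y s) * x') • azimuthal e₁ e₂ (x s) +
        y' • meridional e₁ e₂ e₃ (x s) (y s)) s := by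
  refine ((hy.cos.smul (hasDerivAt_radial hx)).add (hy.sin.smul_const e₃)).congr_deriv ?_
  rw [meridional]; module

theorem hasDerivAt_meridional (hx : HasDerivAt x x' s) (hy : HasDerivAt y y' s) :
    HasDerivAt (fun s => meridional e₁ e₂ e₃ (x s) (y s))
      ((-Real.sin (y s) * x') • azimuthal e₁ e₂ (x s) +
        (-y') • spherical e₁ e₂ e₃ (x s) (y s)) s := by
  refine ((hy.cos.smul_const e₃).sub (hy.sin.smul (hasDerivAt_radial hx))).congr_deriv ?_
  rw [spherical]; module

theorem inner_deriv_azimuthal (he : IsFrame e₁ e₂ e₃) (hx : HasDerivAt x x' s) :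
    inner ℝ (deriv (fun s => azimuthal e₁ e₂ (x s)) s) (meridional e₁ e₂ e₃ (x s) (y s)) =
      x' * Real.sin (y s) := by
  have h := isFrame_azimuthal he (x s)
  rw [(hasDerivAt_azimuthal hx).deriv, meridional]
  simp only [inner_sub_right, inner_smul_left, inner_smul_right, h.three, RCLike.conj_to_real]
  rw [real_inner_comm, h.orth₂₃]; ring

/-- The spherical frame itself rotates about its third vector at rate x' sin y, and turning it by t
adds t'. This gives the twist rate of the buckled rod. -/
theorem inner_deriv_turned₁ (he : IsFrame e₁ e₂ e₃) (hx : HasDerivAt x x' s)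
    (hy : HasDerivAt y y' s) (ht : HasDerivAt t t' s) :
    inner ℝ (deriv (fun s => turned₁ e₁ e₂ e₃ (x s) (y s) (t s)) s)
      (turned₂ e₁ e₂ e₃ (x s) (y s) (t s)) = t' + x' * Real.sin (y s) := by
  have hd : HasDerivAt (fun s => turned₁ e₁ e₂ e₃ (x s) (y s) (t s))
      ((t' + x' * Real.sin (y s)) • turned₂ e₁ e₂ e₃ (x s) (y s) (t s) +
        (-(Real.cos (t s) * x' * Real.cos (y s)) - Real.sin (t s) * y') •
          spherical e₁ e₂ e₃ (x s) (y s)) s := by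
    refine ((ht.cos.smul (hasDerivAt_azimuthal hx)).add
      (ht.sin.smul (hasDerivAt_meridional hx hy))).congr_deriv ?_
    have h1 : radial e₁ e₂ (x s) = Real.cos (y s) • spherical e₁ e₂ e₃ (x s) (y s) -
        Real.sin (y s) • meridional e₁ e₂ e₃ (x s) (y s) := by
      rw [spherical, meridional]
      have : (1 : ℝ) = Real.cos (y s) * Real.cos (y s) + Real.sin (y s) * Real.sin (y s) := by
        linarith [Real.sin_sq_add_cos_sq (y s)]
      conv_lhs => rw [← one_smul ℝ (radial e₁ e₂ (x s)), this]
      module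
    rw [h1, turned₂]
    module
  have h := isFrame_turned he (x s) (y s) (t s)
  rw [hd.deriv, inner_add_left, inner_smul_left, inner_smul_left, h.two, real_inner_comm, h.orth₂₃]
  simp

end Spherical

open Filter Topology in
/-- In a smooth one-parameter family of curves, all derivatives depend on the parameter
continuously, uniformly on compact intervals. -/
theorem eventually_iteratedDeriv_sub_lt {F : ℝ → ℝ → E3}
    (hF : ContDiff ℝ ∞ (Function.uncurry F)) (L : ℝ) (r : ℕ) {ε : ℝ} (hε : 0 < ε) :
    ∀ᶠ p in 𝓝 (0 : ℝ), ∀ s ∈ Set.Icc 0 L, ∀ j ≤ r,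
      ‖iteratedDeriv j (F p) s - iteratedDeriv j (F 0) s‖ < ε := by
  -- Each further s-derivative is the joint derivative in the direction (0, 1), which remains
  -- jointly smooth.
  have smooth : ∀ j : ℕ, ContDiff ℝ ∞ (Function.uncurry fun p s => iteratedDeriv j (F p) s) := by
    intro j
    induction j with
    | zero => simpa [iteratedDeriv_zero] using hF
    | succ j ih =>
      set G : ℝ × ℝ → E3 := Function.uncurry fun p s => iteratedDeriv j (F p) s with hG
      have h1 : (Function.uncurry fun p s => iteratedDeriv (j + 1) (F p) s) =
          fun z => fderiv ℝ G z (0, 1) := by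
        funext ⟨p, s⟩
        change iteratedDeriv (j + 1) (F p) s = _
        rw [iteratedDeriv_succ]
        have h2 : HasDerivAt (fun s : ℝ => (p, s)) ((0 : ℝ), (1 : ℝ)) s :=
          (hasDerivAt_const s p).prodMk (hasDerivAt_id s)
        exact ((ih.differentiable (by simp) (p, s)).hasFDerivAt.comp_hasDerivAt s h2).deriv
      rw [h1]
      exact (ih.fderiv_right (m := ∞) (by simp)).clm_apply contDiff_const
  have h : ∀ j ∈ Finset.range (r + 1), ∀ᶠ p in 𝓝 (0 : ℝ), ∀ s ∈ Set.Icc 0 L,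
      ‖iteratedDeriv j (F p) s - iteratedDeriv j (F 0) s‖ < ε := by
    intro j _
    refine isCompact_Icc.eventually_forall_of_forall_eventually fun s _ => ?_
    have c1 : Continuous fun z : ℝ × ℝ => ‖iteratedDeriv j (F z.1) z.2 -
        iteratedDeriv j (F 0) z.2‖ :=
      ((smooth j).continuous.sub
        ((smooth j).continuous.comp (continuous_const.prodMk continuous_snd))).norm
    refine c1.continuousAt.eventually_lt continuousAt_const ?_
    simpa using hε
  filter_upwards [(Finset.range (r + 1)).eventually_all.2 h] with p hp s hs j hj
  exact hp j (Finset.mem_range.2 (by omega)) s hs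

/-- A periodic function that changes sign under a translation has mean zero. -/
theorem integral_eq_zero_of_antiperiodic {E : Type*} [NormedAddCommGroup E] [NormedSpace ℝ E]
    {g : ℝ → E} {L a : ℝ} (hp : Function.Periodic g L) (ha : ∀ s, g (s + a) = -g s) :
    ∫ s in (0 : ℝ)..L, g s = 0 := by
  have h1 : ∫ s in (0 : ℝ)..L, g (s + a) = ∫ s in (0 : ℝ)..L, g s := by
    rw [intervalIntegral.integral_comp_add_right, zero_add, add_comm L a]
    have := hp.intervalIntegral_add_eq a 0
    rwa [zero_add] at this
  simp_rw [ha, intervalIntegral.integral_neg] at h1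
  have h2 : (2 : ℝ) • ∫ s in (0 : ℝ)..L, g s = 0 := by
    rw [two_smul]; nth_rewrite 1 [← h1]; simp
  simpa using h2

end ElasticRod

/-! ### The buckled rods and their energy density -/

namespace ElasticRod

/-- Latitude of the tangent indicatrix of the buckled rod of amplitude `p`. -/
noncomputable def lat (k p s : ℝ) : ℝ := p * Real.cos (2 * k * s)

/-- Longitude of the tangent indicatrix of the buckled rod of amplitude `p`. -/
noncomputable def lon (k c p s : ℝ) : ℝ := k * s + c * p / (2 * k) * Real.sin (2 * k * s)

theorem hasDerivAt_two_mul (k s : ℝ) : HasDerivAt (fun s => 2 * k * s) (2 * k) s := by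
  simpa using (hasDerivAt_id s).const_mul (2 * k)

theorem hasDerivAt_lat (k p s : ℝ) :
    HasDerivAt (lat k p) (-(2 * k * p * Real.sin (2 * k * s))) s :=
  ((hasDerivAt_two_mul k s).cos.const_mul p).congr_deriv (by ring)

theorem hasDerivAt_lon {k : ℝ} (hk : k ≠ 0) (c p s : ℝ) :
    HasDerivAt (lon k c p) (k + c * p * Real.cos (2 * k * s)) s :=
  (((hasDerivAt_id s).const_mul k).add
    ((hasDerivAt_two_mul k s).sin.const_mul (c * p / (2 * k)))).congr_deriv (by field_simp)

section Smooth

variable {e₁ e₂ e₃ : E3} {k c : ℝ} {X : ℝ → ℝ}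

theorem contDiff_spherical_family : ContDiff ℝ ∞ (Function.uncurry fun p s =>
    spherical e₁ e₂ e₃ (lon k c p s) (lat k p s)) := by
  unfold Function.uncurry spherical radial lon lat
  fun_prop

theorem contDiff_azimuthal_family : ContDiff ℝ ∞ (Function.uncurry fun p s =>
    azimuthal e₁ e₂ (lon k c p s)) := by
  unfold Function.uncurry azimuthal lon
  fun_prop

theorem contDiff_meridional_family : ContDiff ℝ ∞ (Function.uncurry fun p s =>
    meridional e₁ e₂ e₃ (lon k c p s) (lat k p s)) := by
  unfold Function.uncurry meridional radial lon lat
  fun_prop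

theorem contDiff_turned₁_family (sX : ContDiff ℝ ∞ X) : ContDiff ℝ ∞ (Function.uncurry fun p s =>
    turned₁ e₁ e₂ e₃ (lon k c p s) (lat k p s) (X s - p / 2 * Real.sin (2 * k * s))) := by
  unfold Function.uncurry turned₁ meridional azimuthal radial lon lat
  fun_prop

theorem contDiff_turned₂_family (sX : ContDiff ℝ ∞ X) : ContDiff ℝ ∞ (Function.uncurry fun p s =>
    turned₂ e₁ e₂ e₃ (lon k c p s) (lat k p s) (X s - p / 2 * Real.sin (2 * k * s))) := by
  unfold Function.uncurry turned₂ meridional azimuthal radial lon lat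
  fun_prop

theorem contDiff_of_uncurry {F : ℝ → ℝ → E3} (hF : ContDiff ℝ ∞ (Function.uncurry F)) (p : ℝ) :
    ContDiff ℝ ∞ (F p) :=
  hF.comp (contDiff_const.prodMk contDiff_id)

end Smooth

theorem lat_add_half {k L : ℝ} (kL : k * L = 2 * Real.pi) (p s : ℝ) :
    lat k p (s + L / 2) = lat k p s := by
  rw [lat, show 2 * k * (s + L / 2) = 2 * k * s + k * L by ring, kL, Real.cos_add_two_pi, lat]

theorem lat_add_quarter {k L : ℝ} (kL : k * L = 2 * Real.pi) (p s : ℝ) :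
    lat k p (s + L / 4) = -lat k p s := by
  rw [lat, show 2 * k * (s + L / 4) = 2 * k * s + k * L / 2 by ring, kL,
    mul_div_cancel_left₀ _ two_ne_zero, Real.cos_add_pi, lat, mul_neg]

theorem lon_add_half {k L : ℝ} (kL : k * L = 2 * Real.pi) (c p s : ℝ) :
    lon k c p (s + L / 2) = lon k c p s + Real.pi := by
  rw [lon, show 2 * k * (s + L / 2) = 2 * k * s + k * L by ring, kL, Real.sin_add_two_pi, lon]
  linarith

theorem lat_periodic {k L : ℝ} (kL : k * L = 2 * Real.pi) (p : ℝ) :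
    Function.Periodic (lat k p) L := fun s => by
  rw [show s + L = s + L / 2 + L / 2 by ring, lat_add_half kL, lat_add_half kL]

theorem lon_add_period {k L : ℝ} (kL : k * L = 2 * Real.pi) (c p s : ℝ) :
    lon k c p (s + L) = lon k c p s + 2 * Real.pi := by
  rw [show s + L = s + L / 2 + L / 2 by ring, lon_add_half kL, lon_add_half kL]; ring

/-- Closure by symmetry: a shift by L/2 keeps the latitude and adds π to the longitude, reversing
the horizontal part; a shift by L/4 reverses the latitude and hence the vertical part. -/
theorem integral_spherical_lon_lat (e₁ e₂ e₃ : E3) {k L : ℝ} (kL : k * L = 2 * Real.pi)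
    (c p : ℝ) :
    ∫ s in (0 : ℝ)..L, spherical e₁ e₂ e₃ (lon k c p s) (lat k p s) = 0 := by
  have c1 : Continuous (lat k p) := by unfold lat; fun_prop
  have c2 : Continuous (lon k c p) := by unfold lon; fun_prop
  have h1 : ∫ s in (0 : ℝ)..L, Real.cos (lat k p s) • radial e₁ e₂ (lon k c p s) = 0 := by
    refine integral_eq_zero_of_antiperiodic (a := L / 2) (fun s => ?_) fun s => ?_
    · rw [lat_periodic kL, lon_add_period kL, radial, Real.sin_add_two_pi, Real.cos_add_two_pi,
        radial]
    · rw [lat_add_half kL, lon_add_half kL, radial, Real.sin_add_pi, Real.cos_add_pi, radial]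
      module
  have h2 : ∫ s in (0 : ℝ)..L, Real.sin (lat k p s) = 0 := by
    refine integral_eq_zero_of_antiperiodic (a := L / 4) (fun s => ?_) fun s => ?_
    · rw [lat_periodic kL]
    · rw [lat_add_quarter kL, Real.sin_neg]
  unfold spherical
  have c3 : Continuous fun s => Real.cos (lat k p s) • radial e₁ e₂ (lon k c p s) := by
    unfold radial; fun_prop
  rw [intervalIntegral.integral_add (c3.intervalIntegrable _ _)
    ((by fun_prop : Continuous _).intervalIntegrable _ _), h1,
    intervalIntegral.integral_smul_const, h2, zero_smul, add_zero]

namespace Rod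

/-- The buckled rod: its tangent indicatrix has latitude `lat` and longitude `lon`, and its
material frame is turned by a prescribed angle `X` up to a small correction. -/
theorem exists_buckled {L k : ℝ} (kpos : 0 < k) (kL : k * L = 2 * Real.pi) {e₁ e₂ e₃ : E3}
    (he : IsFrame e₁ e₂ e₃) {X : ℝ → ℝ} (sX : ContDiff ℝ ∞ X) (x₀ : E3) {c p : ℝ}
    (hp : |p| ≤ 1) (hcp : |c * p| < k) :
    ∃ Γ : Rod L, Γ.γ 0 = x₀ ∧
      Γ.T = (fun s => spherical e₁ e₂ e₃ (lon k c p s) (lat k p s)) ∧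
      Γ.M₁ = (fun s => turned₁ e₁ e₂ e₃ (lon k c p s) (lat k p s)
        (X s - p / 2 * Real.sin (2 * k * s))) ∧
      Γ.M₂ = (fun s => turned₂ e₁ e₂ e₃ (lon k c p s) (lat k p s)
        (X s - p / 2 * Real.sin (2 * k * s))) ∧
      ∀ s, 0 < (inner ℝ (deriv Γ.T s) (azimuthal e₁ e₂ (lon k c p s)) : ℝ) := by
  set T : ℝ → E3 := fun s => spherical e₁ e₂ e₃ (lon k c p s) (lat k p s) with hT
  have sT : ContDiff ℝ ∞ T := contDiff_of_uncurry contDiff_spherical_family p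
  set γ : ℝ → E3 := fun s => x₀ + ∫ x in (0 : ℝ)..s, T x with hγ
  have dγ : ∀ s, HasDerivAt γ (T s) s := fun s =>
    (intervalIntegral.integral_hasDerivAt_right (sT.continuous.intervalIntegrable _ _)
      (sT.continuous.stronglyMeasurableAtFilter _ _) sT.continuous.continuousAt).const_add _
  have dγ' : deriv γ = T := funext fun s => (dγ s).deriv
  have perT : Function.Periodic T L := fun s => by
    simp only [hT, lat_periodic kL p s, lon_add_period kL, spherical, radial,
      Real.sin_add_two_pi, Real.cos_add_two_pi]
  have hpos : ∀ s, 0 < (inner ℝ (deriv T s) (azimuthal e₁ e₂ (lon k c p s)) : ℝ) := by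
    intro s
    have hf := isFrame_spherical he (lon k c p s) (lat k p s)
    rw [(hasDerivAt_spherical (hasDerivAt_lon kpos.ne' c p s) (hasDerivAt_lat k p s)).deriv,
      inner_add_left, inner_smul_left, inner_smul_left, hf.one, real_inner_comm, hf.orth]
    simp only [RCLike.conj_to_real, mul_one, mul_zero, add_zero]
    have h1 := Real.abs_cos_le_one (2 * k * s)
    -- `hp` keeps the latitude away from the poles and `hcp` keeps the longitude increasing.
    -- Positivity gives both the absence of inflections and the half-plane condition for computing
    -- Δψ.
    refine mul_pos (Real.cos_pos_of_le_one ?_) ?_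
    · rw [lat, abs_mul]; nlinarith [abs_nonneg p, abs_nonneg (Real.cos (2 * k * s))]
    · have h2 : |c * p * Real.cos (2 * k * s)| < k := by
        rw [abs_mul]; nlinarith [abs_nonneg (c * p), abs_nonneg (Real.cos (2 * k * s))]
      linarith [(abs_lt.1 h2).1]
  have hframe := fun s => isFrame_turned he (lon k c p s) (lat k p s)
    (X s - p / 2 * Real.sin (2 * k * s))
  have norm_one : ∀ {v : E3}, inner ℝ v v = (1 : ℝ) → ‖v‖ = 1 := fun {v} h => by
    rwa [← sq_eq_sq₀ (norm_nonneg _) zero_le_one, ← real_inner_self_eq_norm_sq, one_pow]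
  refine ⟨{ γ := γ
            M₁ := _
            M₂ := _
            smooth_γ := contDiff_infty_iff_deriv.2
              ⟨fun s => (dγ s).differentiableAt, by rwa [dγ']⟩
            smooth_M₁ := contDiff_of_uncurry (contDiff_turned₁_family sX) p
            smooth_M₂ := contDiff_of_uncurry (contDiff_turned₂_family sX) p
            closed := fun s => ?_
            unit_speed := fun s => ?_
            no_inflection := fun s h => ?_
            norm_M₁ := fun s => norm_one (hframe s).one
            norm_M₂ := fun s => norm_one (hframe s).two
            orthogonal := fun s => (hframe s).orth
            oriented := fun s => ?_ }, ?_, dγ', rfl, rfl, ?_⟩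
  · have h := perT.intervalIntegral_add_eq 0 s
    rw [zero_add, integral_spherical_lon_lat _ _ _ kL] at h
    simp only [hγ]
    rw [← intervalIntegral.integral_add_adjacent_intervals
      (sT.continuous.intervalIntegrable 0 s) (sT.continuous.intervalIntegrable s (s + L)),
      ← h, add_zero]
  · rw [dγ']; exact norm_one (hframe s).three
  · have := hpos s
    rw [dγ'] at h
    rw [h, inner_zero_left] at this
    exact lt_irrefl _ this
  · rw [dγ']; exact (hframe s).cross_eq
  · simp [hγ]
  · intro s
    change 0 < (inner ℝ (deriv (deriv γ) s) _ : ℝ)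
    rw [dγ']; exact hpos s

end Rod

/-- Expansion to second order in p, with y = cos 2ks, x = sin 2ks and σ = sin(lat) - lat. The term
-k(py) comes from the extra turning -(p/2) sin 2ks of the material frame: it cancels the first-order
part of the twist rate, which would otherwise cost βk²p²y². Every other remainder is either of
favourable sign or at most a multiple of |p|³. -/
theorem energy_density_upper_bound {α β m k c p y x σ : ℝ} (hα : 0 ≤ α) (hβ : 0 ≤ β)
    (hk : 0 ≤ k) (hp : |p| ≤ 1) (hy : |y| ≤ 1) (hσ : |σ| ≤ |p| ^ 3) :
    α * ((1 - (p * y + σ) ^ 2) * (k + c * p * y) ^ 2 + (2 * k * p * x) ^ 2) +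
      β * (m - k * (p * y) + (k + c * p * y) * (p * y + σ)) ^ 2 ≤
    (α * k ^ 2 + β * m ^ 2) + (2 * α * k * c * p) * y +
      p ^ 2 * ((α * (c ^ 2 - k ^ 2) + 2 * β * m * c) * y ^ 2 + 4 * α * k ^ 2 * x ^ 2) +
      (α * (2 * (k + |c|) ^ 2 + 2 * k * |c|) +
        β * (2 * |m| * (k + |c|) + (|c| + (k + |c|)) ^ 2)) * |p| ^ 3 := by
  set W := k + |c| with hW
  set Ω := k + c * p * y with hΩ
  set P := |p| with hP
  have P0 : 0 ≤ P := abs_nonneg p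
  have W0 : 0 ≤ W := by positivity
  have py : |p * y| ≤ P := by
    rw [abs_mul]; exact mul_le_of_le_one_right P0 hy
  have cpy : |c * p * y| ≤ |c| * P := by
    rw [mul_assoc, abs_mul]; gcongr
  have ΩW : |Ω| ≤ W := by
    calc |Ω| ≤ |k| + |c * p * y| := abs_add_le _ _
      _ ≤ k + |c| * P := by rw [abs_of_nonneg hk]; gcongr
      _ ≤ k + |c| * 1 := by gcongr
      _ = W := by rw [mul_one]
  have P32 : P ^ 3 ≤ P ^ 2 := pow_le_pow_of_le_one P0 hp (by norm_num)
  have P43 : P ^ 4 ≤ P ^ 3 := pow_le_pow_of_le_one P0 hp (by norm_num)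
  have A1 : -((p * y) * σ * Ω ^ 2) ≤ W ^ 2 * P ^ 3 := by
    refine (neg_le_abs _).trans ?_
    rw [abs_mul, abs_mul, abs_pow]
    calc |p * y| * |σ| * |Ω| ^ 2 ≤ P * P ^ 3 * W ^ 2 := by gcongr
      _ = W ^ 2 * P ^ 4 := by ring
      _ ≤ W ^ 2 * P ^ 3 := by gcongr
  have A2 : -(c * (p * y) ^ 3) ≤ |c| * P ^ 3 := by
    refine (neg_le_abs _).trans ?_
    rw [abs_mul, abs_pow]; gcongr
  have B1 : m * (Ω * σ) ≤ |m| * (W * P ^ 3) := by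
    refine (le_abs_self _).trans ?_
    rw [abs_mul, abs_mul]; gcongr
  have B2 : (c * (p * y) ^ 2 + Ω * σ) ^ 2 ≤ (|c| + W) ^ 2 * P ^ 3 := by
    have : |c * (p * y) ^ 2 + Ω * σ| ≤ (|c| + W) * P ^ 2 := by
      calc _ ≤ |c * (p * y) ^ 2| + |Ω * σ| := abs_add_le _ _
        _ = |c| * |p * y| ^ 2 + |Ω| * |σ| := by rw [abs_mul, abs_mul, abs_pow]
        _ ≤ |c| * P ^ 2 + W * P ^ 3 := by gcongr
        _ ≤ |c| * P ^ 2 + W * P ^ 2 := by gcongr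
        _ = _ := by ring
    calc _ = |c * (p * y) ^ 2 + Ω * σ| ^ 2 := (sq_abs _).symm
      _ ≤ ((|c| + W) * P ^ 2) ^ 2 := by gcongr
      _ = (|c| + W) ^ 2 * P ^ 4 := by ring
      _ ≤ (|c| + W) ^ 2 * P ^ 3 := by gcongr
  have A3 : 0 ≤ c ^ 2 * (p * y) ^ 4 + σ ^ 2 * Ω ^ 2 := by positivity
  have hA : (1 - (p * y + σ) ^ 2) * Ω ^ 2 + (2 * k * p * x) ^ 2 ≤ k ^ 2 + 2 * k * c * p * y +
      p ^ 2 * ((c ^ 2 - k ^ 2) * y ^ 2 + 4 * k ^ 2 * x ^ 2) +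
      (2 * W ^ 2 + 2 * k * |c|) * P ^ 3 := by
    have e : (1 - (p * y + σ) ^ 2) * Ω ^ 2 = k ^ 2 + 2 * k * c * p * y + p ^ 2 * (c ^ 2 - k ^ 2) *
        y ^ 2 + 2 * k * -(c * (p * y) ^ 3) + 2 * -((p * y) * σ * Ω ^ 2) -
        (c ^ 2 * (p * y) ^ 4 + σ ^ 2 * Ω ^ 2) := by
      rw [hΩ]; ring
    have A2' := mul_le_mul_of_nonneg_left A2 (by positivity : 0 ≤ 2 * k)
    rw [e]; linarith
  have hB : (m - k * (p * y) + Ω * (p * y + σ)) ^ 2 ≤ m ^ 2 + p ^ 2 * (2 * m * c * y ^ 2) +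
      (2 * |m| * W + (|c| + W) ^ 2) * P ^ 3 := by
    have e : m - k * (p * y) + Ω * (p * y + σ) = m + (c * (p * y) ^ 2 + Ω * σ) := by
      rw [hΩ]; ring
    rw [e, add_sq]; linarith
  have := mul_le_mul_of_nonneg_left hA hα
  have := mul_le_mul_of_nonneg_left hB hβ
  linarith

theorem abs_sin_sub_self_le {h : ℝ} (hh : |h| ≤ 1) : |Real.sin h - h| ≤ |h| ^ 3 := by
  have h1 := Real.sin_bound hh
  have h2 : |h| ^ 5 ≤ |h| ^ 3 := pow_le_pow_of_le_one (abs_nonneg _) hh (by norm_num)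
  calc |Real.sin h - h| = |(Real.sin h - (h - h ^ 3 / 6)) + -(h ^ 3 / 6)| := by congr 1; ring
    _ ≤ |Real.sin h - (h - h ^ 3 / 6)| + |-(h ^ 3 / 6)| := abs_add_le _ _
    _ = |Real.sin h - (h - h ^ 3 / 6)| + |h| ^ 3 / 6 := by
      rw [abs_neg, abs_div, abs_pow]; norm_num
    _ ≤ |h| ^ 3 := by linarith [pow_nonneg (abs_nonneg h) 3]

end ElasticRod

/-! ### Total twist and energy of the buckled rods; instability under large twist -/

namespace ElasticRod

namespace Rod

variable {L : ℝ}

/-- The total twist and the energy of the buckled rod. -/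
theorem hasDeltaPsi_and_energy_of_buckled (hL : 0 < L) {k : ℝ} (hk : k = 2 * Real.pi / L)
    {e₁ e₂ e₃ : E3} (he : IsFrame e₁ e₂ e₃) {X : ℝ → ℝ} {u : ℝ → ℝ}
    (dX : ∀ s, HasDerivAt X (u s) s) {m α β : ℝ} (hu : ∀ s ∈ Set.Icc 0 L, u s = m) (hα : 0 ≤ α)
    (hβ : 0 ≤ β) {c p : ℝ} (hp : |p| ≤ 1) {Γ : Rod L}
    (hT : Γ.T = (fun s => spherical e₁ e₂ e₃ (lon k c p s) (lat k p s)))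
    (hM₁ : Γ.M₁ = (fun s => turned₁ e₁ e₂ e₃ (lon k c p s) (lat k p s)
        (X s - p / 2 * Real.sin (2 * k * s))))
    (hM₂ : Γ.M₂ = (fun s => turned₂ e₁ e₂ e₃ (lon k c p s) (lat k p s)
        (X s - p / 2 * Real.sin (2 * k * s))))
    (pos : ∀ s, 0 < (inner ℝ (deriv Γ.T s) (azimuthal e₁ e₂ (lon k c p s)) : ℝ)) :
    Γ.HasDeltaPsi (m * L) ∧ energy α β Γ ≤ (α * k ^ 2 + β * m ^ 2) * L +
      p ^ 2 * (α * (c ^ 2 + 3 * k ^ 2) + 2 * β * m * c) * (L / 2) +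
      (α * (2 * (k + |c|) ^ 2 + 2 * k * |c|) +
        β * (2 * |m| * (k + |c|) + (|c| + (k + |c|)) ^ 2)) * |p| ^ 3 * L := by
  have hpi := Real.pi_pos
  have kpos : 0 < k := by rw [hk]; positivity
  have kL : k * L = 2 * Real.pi := by rw [hk]; field_simp
  have dlat := hasDerivAt_lat k p
  have dlon := hasDerivAt_lon kpos.ne' c p
  have icr : ∀ {f : ℝ → ℝ}, Continuous f → IntervalIntegrable f MeasureTheory.volume 0 L :=
    fun hf => hf.intervalIntegrable 0 L
  have hf : ∀ s, IsFrame (azimuthal e₁ e₂ (lon k c p s))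
      (meridional e₁ e₂ e₃ (lon k c p s) (lat k p s)) (Γ.T s) := fun s => by
    rw [hT]; exact isFrame_spherical he _ _
  have hu₃ : ∀ s, Γ.u₃ s = u s - k * lat k p s +
      (k + c * p * Real.cos (2 * k * s)) * Real.sin (lat k p s) := fun s => by
    rw [u₃, hM₁, hM₂]
    have h := (dX s).sub ((hasDerivAt_two_mul k s).sin.const_mul (p / 2))
    refine (inner_deriv_turned₁ he (dlon s) (dlat s) h).trans ?_
    rw [lat]; ring
  have scs : Real.cos (2 * k * L) = 1 ∧ Real.sin (2 * k * L) = 0 := by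
    rw [mul_assoc, kL, Real.cos_two_mul, Real.sin_two_mul, Real.cos_two_pi, Real.sin_two_pi]
    norm_num
  have d2 := hasDerivAt_two_mul k
  have Ic : ∫ s in (0 : ℝ)..L, Real.cos (2 * k * s) = 0 := by
    rw [intervalIntegral.integral_eq_sub_of_hasDerivAt
      (f := fun s => Real.sin (2 * k * s) / (2 * k))
      (fun s _ => ((d2 s).sin.div_const (2 * k)).congr_deriv (by field_simp))
      (icr (by fun_prop))]
    simp [scs]
  have Icc' : ∫ s in (0 : ℝ)..L, Real.cos (2 * k * s) ^ 2 = L / 2 := by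
    rw [intervalIntegral.integral_eq_sub_of_hasDerivAt
      (f := fun s => s / 2 + Real.sin (2 * k * s) * Real.cos (2 * k * s) / (4 * k))
      (fun s _ => (((hasDerivAt_id s).div_const 2).add
        (((d2 s).sin.mul (d2 s).cos).div_const (4 * k))).congr_deriv (by
          field_simp; linarith [Real.sin_sq_add_cos_sq (2 * k * s)]))
      (icr (by fun_prop))]
    simp [scs]
  have Iss : ∫ s in (0 : ℝ)..L, Real.sin (2 * k * s) ^ 2 = L / 2 := by
    have : ∀ s, Real.sin (2 * k * s) ^ 2 = 1 - Real.cos (2 * k * s) ^ 2 := fun s => by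
      linarith [Real.sin_sq_add_cos_sq (2 * k * s)]
    simp_rw [this]
    rw [intervalIntegral.integral_sub (icr (by fun_prop)) (icr (by fun_prop)), Icc']
    simp; ring
  constructor
  · have pL : lat k p L = lat k p 0 := by have := lat_periodic kL p 0; rwa [zero_add] at this
    have nL : lon k c p L = lon k c p 0 + 2 * Real.pi := by
      have := lon_add_period kL c p 0; rwa [zero_add] at this
    rw [Γ.hasDeltaPsi_iff hL.le hf (contDiff_of_uncurry contDiff_azimuthal_family p)
      (contDiff_of_uncurry contDiff_meridional_family p) (by simp [azimuthal, nL])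
      (by simp [meridional, radial, nL, pL]) pos]
    -- The twist rate of the spherical frame cancels, leaving m plus a cosine of mean zero, so Δψ
    -- does not depend on p.
    have h1 : ∫ s in (0 : ℝ)..L, (Γ.u₃ s - inner ℝ (deriv (fun s =>
        azimuthal e₁ e₂ (lon k c p s)) s) (meridional e₁ e₂ e₃ (lon k c p s) (lat k p s))) =
        ∫ s in (0 : ℝ)..L, (m - k * p * Real.cos (2 * k * s)) := by
      refine intervalIntegral.integral_congr fun s hs => ?_
      rw [Set.uIcc_of_le hL.le] at hs
      beta_reduce
      rw [inner_deriv_azimuthal he (dlon s), hu₃, hu s hs]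
      simp only [lat]; ring
    rw [h1, intervalIntegral.integral_sub (icr (by fun_prop)) (icr (by fun_prop)),
      intervalIntegral.integral_const_mul, Ic]
    simp [mul_comm]
  · set C := α * (2 * (k + |c|) ^ 2 + 2 * k * |c|) +
        β * (2 * |m| * (k + |c|) + (|c| + (k + |c|)) ^ 2) with hC
    have point : ∀ s ∈ Set.Icc 0 L, α * (Γ.u₁ s ^ 2 + Γ.u₂ s ^ 2) + β * Γ.u₃ s ^ 2 ≤
        ((α * k ^ 2 + β * m ^ 2) + C * |p| ^ 3) + (2 * α * k * c * p) * Real.cos (2 * k * s) +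
        (p ^ 2 * (α * (c ^ 2 - k ^ 2) + 2 * β * m * c)) * Real.cos (2 * k * s) ^ 2 +
        (p ^ 2 * (4 * α * k ^ 2)) * Real.sin (2 * k * s) ^ 2 := by
      intro s hs
      have hff := isFrame_spherical he (lon k c p s) (lat k p s)
      have hcos : Real.cos (lat k p s) ^ 2 = 1 - Real.sin (lat k p s) ^ 2 := by
        linarith [Real.sin_sq_add_cos_sq (lat k p s)]
      have hlat : |lat k p s| ≤ |p| := by
        rw [lat, abs_mul]
        exact mul_le_of_le_one_right (abs_nonneg p) (Real.abs_cos_le_one _)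
      have hσ : |Real.sin (lat k p s) - lat k p s| ≤ |p| ^ 3 :=
        (abs_sin_sub_self_le (hlat.trans hp)).trans (by gcongr)
      have hdT : deriv Γ.T s = (Real.cos (lat k p s) * (k + c * p * Real.cos (2 * k * s))) •
          azimuthal e₁ e₂ (lon k c p s) + (-(2 * k * p * Real.sin (2 * k * s))) •
          meridional e₁ e₂ e₃ (lon k c p s) (lat k p s) := by
        rw [hT]; exact (hasDerivAt_spherical (dlon s) (dlat s)).deriv
      rw [Γ.u₁_sq_add_u₂_sq (hf s), hdT, hu₃, hu s hs]
      have horth := (real_inner_comm _ _).trans hff.orth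
      simp only [inner_add_left, inner_smul_left, hff.one, hff.two, hff.orth, horth,
        RCLike.conj_to_real]
      have key := energy_density_upper_bound (α := α) (β := β) (m := m) (k := k) (c := c)
        (p := p) (y := Real.cos (2 * k * s)) (x := Real.sin (2 * k * s)) hα hβ kpos.le hp
        (Real.abs_cos_le_one _) hσ
      rw [← hC, show p * Real.cos (2 * k * s) = lat k p s from rfl, add_sub_cancel] at key
      refine le_trans (le_of_eq ?_) (key.trans (le_of_eq ?_))
      · rw [← hcos]; ring
      · ring
    have hmono := intervalIntegral.integral_mono_on (μ := MeasureTheory.volume) hL.le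
      (icr (Γ.continuous_energy_density α β)) (icr (by fun_prop)) point
    refine hmono.trans (le_of_eq ?_)
    rw [intervalIntegral.integral_add (icr (by fun_prop)) (icr (by fun_prop)),
      intervalIntegral.integral_add (icr (by fun_prop)) (icr (by fun_prop)),
      intervalIntegral.integral_add (icr (by fun_prop)) (icr (by fun_prop)),
      intervalIntegral.integral_const_mul, intervalIntegral.integral_const_mul,
      intervalIntegral.integral_const_mul, Ic, Icc', Iss]
    simp only [intervalIntegral.integral_const, smul_eq_mul, sub_zero]
    ring

open Filter Topology in
theorem not_isStable_of_large_twist {Γ : Rod L} {α β m : ℝ} (hL : 0 < L) (hα : 0 ≤ α)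
    (hβ : 0 < β) (hcirc : Γ.HasCircularCenterline) (hm : Γ.HasConstantTwistRate m) (r : ℕ)
    (hlarge : Real.sqrt 3 * (α * (2 * Real.pi / L)) < β * |m|) : ¬ Γ.IsStable α β r := by
  rintro ⟨ε, εpos, hstab⟩
  obtain ⟨e₁, e₂, e₃, he, hT⟩ := hcirc.exists_frame hL
  have hf := isFrame_of_circle he hT
  have hd := (hasDeltaPsi_circle_iff hL he hT hm (m * L)).2 rfl
  have hE := energy_circle hL he hT hm α β
  set k := 2 * Real.pi / L with hk
  have hpi := Real.pi_pos
  have kpos : 0 < k := by positivity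
  have kL : k * L = 2 * Real.pi := by rw [hk]; field_simp
  have dks : ∀ s, HasDerivAt (fun s => k * s) k s := fun s => by
    simpa using (hasDerivAt_id s).const_mul k
  obtain ⟨X, sX, dX, hX⟩ := exists_angle Γ.isFrame hf Γ.smooth_M₁ Γ.smooth_M₂ (by fun_prop)
    contDiff_const
  have dX' : ∀ s, HasDerivAt X (Γ.u₃ s) s := fun s => by
    refine (dX s).congr_deriv ?_
    have d1 : HasDerivAt (fun s => (-Real.cos (k * s)) • e₁ + (-Real.sin (k * s)) • e₂) _ s :=
      ((dks s).cos.neg.smul_const e₁).add ((dks s).sin.neg.smul_const e₂)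
    rw [d1.deriv, inner_add_left, inner_smul_left, inner_smul_left, he.orth₁₃, he.orth₂₃, u₃]
    simp
  -- the direction of buckling depends on the sign of the twist
  obtain ⟨c, hc⟩ : ∃ c : ℝ, α * (c ^ 2 + 3 * k ^ 2) + 2 * β * m * c < 0 := by
    have h3 : Real.sqrt 3 ^ 2 = 3 := Real.sq_sqrt (by norm_num)
    have h30 : 0 < Real.sqrt 3 := by positivity
    have h4 := mul_lt_mul_of_pos_left hlarge (by positivity : 0 < 2 * Real.sqrt 3 * k)
    rcases le_total 0 m with h | h
    · refine ⟨-(Real.sqrt 3 * k), ?_⟩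
      rw [abs_of_nonneg h] at h4
      rw [neg_sq, mul_pow, h3]
      have h5 : 2 * Real.sqrt 3 * k * (Real.sqrt 3 * (α * k)) = 6 * α * k ^ 2 := by
        linear_combination 2 * α * k ^ 2 * h3
      linarith
    · refine ⟨Real.sqrt 3 * k, ?_⟩
      rw [abs_of_nonpos h] at h4
      rw [mul_pow, h3]
      have h5 : 2 * Real.sqrt 3 * k * (Real.sqrt 3 * (α * k)) = 6 * α * k ^ 2 := by
        linear_combination 2 * α * k ^ 2 * h3
      linarith
  set C := α * (2 * (k + |c|) ^ 2 + 2 * k * |c|) +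
    β * (2 * |m| * (k + |c|) + (|c| + (k + |c|)) ^ 2) with hC
  set D := α * (c ^ 2 + 3 * k ^ 2) + 2 * β * m * c with hD
  -- The centerlines start at the same point, so tangents within ε' yield centerlines within ε'L <
  -- ε.
  set ε' := ε / (L + 1) with hε'
  have ε'pos : 0 < ε' := by positivity
  have ε'le : ε' ≤ ε := div_le_self εpos.le (by linarith)
  have zT : (fun s => spherical e₁ e₂ e₃ (lon k c 0 s) (lat k 0 s)) = Γ.T := by
    funext s; rw [hT]; simp [spherical, radial, lon, lat]
  have zM₁ : (fun s => turned₁ e₁ e₂ e₃ (lon k c 0 s) (lat k 0 s)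
      (X s - 0 / 2 * Real.sin (2 * k * s))) = Γ.M₁ := by
    funext s; rw [hX]; simp [turned₁, azimuthal, meridional, lon, lat]
  have zM₂ : (fun s => turned₂ e₁ e₂ e₃ (lon k c 0 s) (lat k 0 s)
      (X s - 0 / 2 * Real.sin (2 * k * s))) = Γ.M₂ := by
    funext s
    rw [← (Γ.isFrame s).cross₃₁, ← zT, ← zM₁]
    exact (isFrame_turned he _ _ _).cross₃₁.symm
  have cT := eventually_iteratedDeriv_sub_lt (contDiff_spherical_family (e₁ := e₁) (e₂ := e₂)
    (e₃ := e₃) (k := k) (c := c)) L r ε'pos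
  have cM₁ := eventually_iteratedDeriv_sub_lt (contDiff_turned₁_family (e₁ := e₁) (e₂ := e₂)
    (e₃ := e₃) (k := k) (c := c) sX) L r ε'pos
  have cM₂ := eventually_iteratedDeriv_sub_lt (contDiff_turned₂_family (e₁ := e₁) (e₂ := e₂)
    (e₃ := e₃) (k := k) (c := c) sX) L r ε'pos
  rw [zT] at cT
  rw [zM₁] at cM₁
  rw [zM₂] at cM₂
  have small : ∀ {f : ℝ → ℝ} {b : ℝ}, Continuous f → f 0 < b → ∀ᶠ p in 𝓝 (0 : ℝ), f p < b :=
    fun hf hb => hf.continuousAt.eventually_lt continuousAt_const hb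
  have s1 := small (f := fun p => |p|) (b := 1) (by fun_prop) (by simp)
  have s2 := small (f := fun p => |c * p|) (b := k) (by fun_prop) (by simpa using kpos)
  -- Up to the factor p²L, this bounds the energy difference; since D < 0 it is negative for small
  -- p. Below, p > 0 excludes the circle itself.
  have s3 := small (f := fun p => D * (1 / 2) + C * |p|) (b := 0) (by fun_prop)
    (by simp; linarith)
  have all := (((((cT.and cM₁).and cM₂).and s1).and s2).and s3).filter_mono
    (nhdsWithin_le_nhds (s := Set.Ioi 0))
  obtain ⟨p, ⟨⟨⟨⟨⟨hcT, hcM₁⟩, hcM₂⟩, hp1⟩, hp2⟩, hp3⟩, hp0⟩ :=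
    (all.and self_mem_nhdsWithin).exists
  have hp0 : 0 < p := hp0
  obtain ⟨Γ', gγ, gT, gM₁, gM₂, gpos⟩ := exists_buckled kpos kL he sX (Γ.γ 0) hp1.le hp2
  obtain ⟨hd', hE'⟩ := hasDeltaPsi_and_energy_of_buckled hL hk he dX' hm hα hβ.le hp1.le gT gM₁
    gM₂ gpos
  rw [← gT] at hcT
  rw [← gM₁] at hcM₁
  rw [← gM₂] at hcM₂
  have hclose : Close r ε Γ Γ' := by
    intro s hs
    refine ⟨?_, fun j hj => ⟨(hcT s hs j hj).trans_le ε'le, (hcM₁ s hs j hj).trans_le ε'le,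
      (hcM₂ s hs j hj).trans_le ε'le⟩⟩
    have h1 := intervalIntegral.integral_eq_sub_of_hasDerivAt (a := 0) (b := s)
      (fun x _ => (Γ'.hasDerivAt_γ x).sub (Γ.hasDerivAt_γ x))
      ((Γ'.smooth_T.continuous.sub Γ.smooth_T.continuous).intervalIntegrable _ _)
    simp only [Pi.sub_apply, gγ, sub_self, sub_zero] at h1
    have h2 : ‖∫ x in (0 : ℝ)..s, (Γ'.T x - Γ.T x)‖ ≤ ε' * |s - 0| := by
      refine intervalIntegral.norm_integral_le_of_norm_le_const fun x hx => ?_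
      rw [Set.uIoc_of_le hs.1] at hx
      have := hcT x ⟨hx.1.le, hx.2.trans hs.2⟩ 0 (Nat.zero_le r)
      rw [iteratedDeriv_zero, iteratedDeriv_zero] at this
      exact this.le
    rw [← h1]
    refine h2.trans_lt ?_
    rw [sub_zero, abs_of_nonneg hs.1, hε', div_mul_eq_mul_div, div_lt_iff₀ (by positivity)]
    have := hs.2
    nlinarith
  have hle := hstab Γ' ⟨_, hd, hd'⟩ hclose
  rw [hE] at hle
  have hneg : p ^ 2 * L * (D * (1 / 2) + C * |p|) < 0 :=
    mul_neg_of_pos_of_neg (by positivity) hp3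
  rw [abs_of_pos hp0] at hneg hE'
  linarith

end Rod

end ElasticRod

/-! ### The two regimes in terms of |m| -/

theorem mainTheorem7 (α β L m : ℝ) (hα : 0 ≤ α) (hβ : 0 < β) (hL : 0 < L)
    (Γ : ElasticRod.Rod L) (hcirc : Γ.HasCircularCenterline)
    (hm : Γ.HasConstantTwistRate m) (r : ℕ) (hr : 1 ≤ r) :
    (|m| < Real.sqrt 3 * (2 * Real.pi * α / (L * β)) → Γ.IsStable α β r) ∧
    (Real.sqrt 3 * (2 * Real.pi * α / (L * β)) < |m| → ¬ Γ.IsStable α β r) := by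
  have hpi := Real.pi_pos
  have e : β * (Real.sqrt 3 * (2 * Real.pi * α / (L * β))) =
      Real.sqrt 3 * (α * (2 * Real.pi / L)) := by field_simp
  constructor
  · intro h
    -- For α = 0 the threshold is zero, and no m lies below it.
    have hα' : 0 < α := by
      rcases hα.eq_or_lt with rfl | h0
      · simp at h; exact absurd h (not_lt.2 (abs_nonneg m))
      · exact h0
    refine ElasticRod.Rod.isStable_of_small_twist hL hα' hβ.le hcirc hm hr ?_
    have h1 := mul_lt_mul_of_pos_left h hβ
    rw [e] at h1
    have h2 : (β * |m|) ^ 2 < (Real.sqrt 3 * (α * (2 * Real.pi / L))) ^ 2 := by gcongr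
    rwa [mul_pow, sq_abs, ← mul_pow, mul_pow (Real.sqrt 3), Real.sq_sqrt (by norm_num)] at h2
  · intro h
    refine ElasticRod.Rod.not_isStable_of_large_twist hL hα hβ hcirc hm r ?_
    have h1 := mul_lt_mul_of_pos_left h hβ
    rwa [e] at h1
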